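/- Let $G$ be a compact Lie group with Lie algebra $\mathfrak g$, let $H\subset G$ be a compact Lie subgroup with Lie algebra $\mathfrak h$, and fix an $\operatorname{Ad}_G$-invariant inner product $Q$ on $\mathfrak g$. Put $\mathfrak m=\mathfrak h^{\perp_Q}$, identified with the tangent space of $G/H$ at $eH$. Let $\mathcal M$ be the space of $G$-invariant Riemannian metrics on $G/H$, i.e. of $\operatorname{Ad}_H$-invariant inner products on $\mathfrak m$, with its natural topology as a subset of the finite-dimensional space of bilinear forms on $\mathfrak m$. Let $T$ be a positive-definite $G$-invariant symmetric $(0,2)$-tensor field on $G/H$, let $\mathcal M_T=\{g\in\mathcal M\mid \operatorname{tr}_gT=1\}$, and let $S(g)$ be the scalar curvature of $g\in\mathcal M$. An intermediate subalgebra is a Lie subalgebra $\mathfrak k$ of $\mathfrak g$ with $\mathfrak h\subsetneq\mathfrak k\subsetneq\mathfrak g$ and $\operatorname{Ad}_H\mathfrak k=\mathfrak k$ (the last condition is automatic if $H$ is connected). For such $\mathfrak k$, let $\mathcal M(K/H)$ be the set of $\operatorname{Ad}_H$-invariant inner products on $\mathfrak k\cap\mathfrak m$, regarded as homogeneous metrics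 on $K/H$, where $K$ is an intermediate (not necessarily closed) subgroup $H\subset K\subset G$ with Lie algebra $\mathfrak k$. Define $$\alpha_{\mathfrak k}=\sup\{S(h)\mid h\in\mathcal M(K/H),\ \operatorname{tr}_h(T_{|\mathfrak k\cap\mathfrak m})=1\},\qquad \alpha_{G/H}=\sup_{\mathfrak k}\alpha_{\mathfrak k},$$ where the last supremum is over all intermediate subalgebras and equals $-\infty$ if there are none. If $a\in\mathbb R$ and $a>\alpha_{G/H}$, then the superlevel set $\{g\in\mathcal M_T\mid S(g)\ge a\}$ is a (possibly empty) compact subset of $\mathcal M_T$. -/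

import Mathlib

open scoped Manifold ContDiff

noncomputable section

namespace HomogeneousSpace

/-! ### Inner products on finite-dimensional real vector spaces -/

/-- An inner product on a real vector space. -/
structure InnerForm (V : Type*) [AddCommGroup V] [Module ℝ V] where
  form : LinearMap.BilinForm ℝ V
  symm : ∀ X Y, form X Y = form Y X
  pos : ∀ X, X ≠ 0 → 0 < form X X

namespace InnerForm

section Basic

variable {V : Type*} [AddCommGroup V] [Module ℝ V]

theorem nondegenerate (g : InnerForm V) : g.form.Nondegenerate := by
  refine ⟨fun X hX => ?_, fun X hX => ?_⟩ <;>
  · by_contra h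
    exact (g.pos X h).ne' (hX X)

/-- The restriction of an inner product to a subspace. -/
def restrict (g : InnerForm V) (p : Submodule ℝ V) : InnerForm p where
  form := g.form.restrict p
  symm X Y := g.symm X Y
  pos X hX := g.pos X (fun h => hX (Subtype.ext h))

/-- The orthogonal complement of a subspace. -/
def orthogonal (g : InnerForm V) (p : Submodule ℝ V) : Submodule ℝ V :=
  g.form.orthogonal p

/-- The identification of the dual space with the space given by the inner product `g`:
`g (g.sharp φ) Z = φ Z`. -/
def sharp [Module.Finite ℝ V] (g : InnerForm V) : Module.Dual ℝ V ≃ₗ[ℝ] V :=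
  (g.form.toDual g.nondegenerate).symm

/-- The trace `tr_g A` of a bilinear form `A` with respect to the inner product `g`. -/
def traceForm [Module.Finite ℝ V] (g : InnerForm V) (A : LinearMap.BilinForm ℝ V) : ℝ :=
  LinearMap.trace ℝ V (g.sharp.toLinearMap ∘ₗ A)

/-- The `g`-orthogonal projection onto the subspace `p`. -/
def proj [Module.Finite ℝ V] (g : InnerForm V) (p : Submodule ℝ V) : V →ₗ[ℝ] p :=
  (g.restrict p).sharp.toLinearMap ∘ₗ p.subtype.dualMap ∘ₗ g.form

end Basic

end InnerForm

/-! ### Curvature of homogeneous metrics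

Here `L` is the Lie algebra of the group, `Q` an inner product on `L`, and `p ⊆ L` is the
`Q`-orthogonal complement of the isotropy subalgebra `𝔥` in a subalgebra `𝔨 = 𝔥 ⊕ p`. The space
`p` is the tangent space of `K/H` at the base point, and an `Ad_H`-invariant inner product `g` on
`p` is a `K`-invariant metric on `K/H`. -/

section Curvature

variable {L : Type*} [LieRing L] [LieAlgebra ℝ L] [Module.Finite ℝ L]

/-- `[X, Y]_p`, the component in `p` of the bracket of `X, Y ∈ p`. -/
def bracketP (Q : InnerForm L) (p : Submodule ℝ L) : p →ₗ[ℝ] p →ₗ[ℝ] p :=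
  LinearMap.mk₂ ℝ (fun X Y => Q.proj p ⁅(X : L), (Y : L)⁆)
    (by intros; simp) (by intros; simp) (by intros; simp) (by intros; simp)

/-- `[[X, Y]_𝔥, Z]` for `X, Y, Z ∈ p`, where `[X, Y]_𝔥 = [X, Y] - [X, Y]_p`. -/
def isotropyP (Q : InnerForm L) (p : Submodule ℝ L) : p →ₗ[ℝ] p →ₗ[ℝ] Module.End ℝ p :=
  LinearMap.mk₂ ℝ
    (fun X Y =>
      Q.proj p ∘ₗ (LieAlgebra.ad ℝ L (⁅(X : L), (Y : L)⁆ - (bracketP Q p X Y : L)) :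
        L →ₗ[ℝ] L) ∘ₗ p.subtype)
    (by intros; ext; simp; abel) (by intros; ext; simp [smul_sub])
    (by intros; ext; simp; abel) (by intros; ext; simp [smul_sub])

/-- The Levi-Civita connection of the homogeneous metric `g` at the base point, as a bilinear map
`(X, Y) ↦ Λ(X)Y` on `p`: it is determined by
`2 g(Λ(X)Y, Z) = g([X, Y]_p, Z) + g([Z, X]_p, Y) + g([Z, Y]_p, X)`. -/
def leviCivita (Q : InnerForm L) (p : Submodule ℝ L) (g : InnerForm p) :
    p →ₗ[ℝ] Module.End ℝ p :=
  LinearMap.mk₂ ℝ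
    (fun X Y => g.sharp ((1 / 2 : ℝ) •
      (g.form (bracketP Q p X Y) + g.form Y ∘ₗ (bracketP Q p).flip X
        + g.form X ∘ₗ (bracketP Q p).flip Y)))
    (by intros; rw [← map_add]; congr 1; ext; simp; ring)
    (by intros; rw [← map_smul]; congr 1; ext; simp; ring)
    (by intros; rw [← map_add]; congr 1; ext; simp; ring)
    (by intros; rw [← map_smul]; congr 1; ext; simp; ring)

/-- The curvature tensor of the homogeneous metric `g` at the base point,
`R(X, Y) = Λ(X)Λ(Y) - Λ(Y)Λ(X) - Λ([X, Y]_p) - ad([X, Y]_𝔥)`. -/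
def curvature (Q : InnerForm L) (p : Submodule ℝ L) (g : InnerForm p) :
    p →ₗ[ℝ] p →ₗ[ℝ] Module.End ℝ p :=
  LinearMap.mk₂ ℝ
    (fun X Y => leviCivita Q p g X * leviCivita Q p g Y - leviCivita Q p g Y * leviCivita Q p g X
      - leviCivita Q p g (bracketP Q p X Y) - isotropyP Q p X Y)
    (by intros; simp only [map_add, LinearMap.add_apply, add_mul, mul_add]; abel)
    (by intros; simp only [map_smul, LinearMap.smul_apply, smul_mul_assoc, mul_smul_comm,
      smul_sub])
    (by intros; simp only [map_add, add_mul, mul_add]; abel)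
    (by intros; simp only [map_smul, smul_mul_assoc, mul_smul_comm, smul_sub])

/-- The Ricci curvature `Ric(Y, Z) = tr (X ↦ R(X, Y)Z)`. -/
def ricci (Q : InnerForm L) (p : Submodule ℝ L) (g : InnerForm p) : LinearMap.BilinForm ℝ p :=
  LinearMap.mk₂ ℝ
    (fun Y Z => LinearMap.trace ℝ p (((curvature Q p g).flip Y).flip Z))
    (by intros; rw [← map_add]; congr 1; ext; simp)
    (by intros; rw [← map_smul]; congr 1; ext; simp)
    (by intros; rw [← map_add]; congr 1; ext; simp)
    (by intros; rw [← map_smul]; congr 1; ext; simp)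

/-- The scalar curvature `S(g) = tr_g Ric(g)`. -/
def scalarCurvature (Q : InnerForm L) (p : Submodule ℝ L) (g : InnerForm p) : ℝ :=
  g.traceForm (ricci Q p g)

end Curvature

/-! ### The homogeneous space `G/H` -/

instance leInfty_minSmoothness_three : ENat.LEInfty (minSmoothness ℝ 3) := ⟨by
  rw [minSmoothness_of_isRCLikeNormedField]
  exact ENat.LEInfty.out⟩

section Group

variable {E : Type*} [NormedAddCommGroup E] [NormedSpace ℝ E] [FiniteDimensional ℝ E]
  {G : Type*} [TopologicalSpace G] [ChartedSpace E G] [Group G]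

/-- The Lie algebra `𝔤 = T_1 G` of the Lie group `G` modelled on `E`. -/
abbrev LieAlg (E : Type*) [NormedAddCommGroup E] [NormedSpace ℝ E]
    (G : Type*) [TopologicalSpace G] [ChartedSpace E G] [Group G] : Type _ :=
  GroupLieAlgebra 𝓘(ℝ, E) G

instance finite_lieAlg : Module.Finite ℝ (LieAlg E G) :=
  inferInstanceAs (Module.Finite ℝ E)

/-- The adjoint representation: `Ad x` is the differential at `1` of `y ↦ x * y * x⁻¹`. -/
def Ad (x : G) : LieAlg E G →ₗ[ℝ] LieAlg E G :=
  ContinuousLinearMap.toLinearMap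
    (mfderiv 𝓘(ℝ, E) 𝓘(ℝ, E) (fun y : G => x * y * x⁻¹) 1 : LieAlg E G →L[ℝ] LieAlg E G)

/-- The Lie algebra `𝔥 ⊆ 𝔤` of a Lie subgroup `H` of `G`: the image of `T_1 H` under the
differential of the inclusion. -/
def lieOfSubgroup (E : Type*) [NormedAddCommGroup E] [NormedSpace ℝ E]
    (F : Type*) [NormedAddCommGroup F] [NormedSpace ℝ F]
    {G : Type*} [TopologicalSpace G] [ChartedSpace E G] [Group G]
    (H : Subgroup G) [ChartedSpace F H] : Submodule ℝ (LieAlg E G) :=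
  LinearMap.range (ContinuousLinearMap.toLinearMap
    (mfderiv 𝓘(ℝ, F) 𝓘(ℝ, E) (Subtype.val : H → G) 1 : LieAlg F H →L[ℝ] LieAlg E G))

/-- A bi-invariant metric on `𝔤`: an `Ad_G`-invariant inner product. -/
def IsBiInvariant (Q : InnerForm (LieAlg E G)) : Prop :=
  ∀ (x : G) (X Y : LieAlg E G), Q.form (Ad x X) (Ad x Y) = Q.form X Y

/-- `Ad_H`-invariant inner products on a subspace `p` of `𝔤`. -/
structure InvariantMetric (H : Subgroup G) (p : Submodule ℝ (LieAlg E G)) extends InnerForm p where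
  invariant : ∀ x ∈ H, ∀ X Y X' Y' : p, (X' : LieAlg E G) = Ad x (X : LieAlg E G) →
    (Y' : LieAlg E G) = Ad x (Y : LieAlg E G) → form X' Y' = form X Y

/-- The topology on the space of metrics, a subspace of the finite-dimensional space of bilinear
forms on `p`: the topology of pointwise convergence `g ↦ g(X, Y)`. -/
instance topologicalSpace_metrics (H : Subgroup G) (p : Submodule ℝ (LieAlg E G)) :
    TopologicalSpace (InvariantMetric H p) :=
  TopologicalSpace.induced (fun g => fun (X Y : p) => g.form X Y) inferInstance

variable {F : Type*} [NormedAddCommGroup F] [NormedSpace ℝ F]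

/-- The isotropy representation `𝔪 = 𝔥^⊥`, i.e. the tangent space of `G/H` at the base point. -/
abbrev isotropySpace (F : Type*) [NormedAddCommGroup F] [NormedSpace ℝ F]
    (Q : InnerForm (LieAlg E G)) (H : Subgroup G) [ChartedSpace F H] : Submodule ℝ (LieAlg E G) :=
  Q.orthogonal (lieOfSubgroup E F H)

/-- The tangent space `𝔨 ∩ 𝔪` of `K/H` at the base point. -/
abbrev fiberSpace (F : Type*) [NormedAddCommGroup F] [NormedSpace ℝ F]
    (Q : InnerForm (LieAlg E G)) (H : Subgroup G) [ChartedSpace F H]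
    (k : Submodule ℝ (LieAlg E G)) : Submodule ℝ (LieAlg E G) :=
  k ⊓ isotropySpace F Q H

/-- The space `𝓜(G/H)` of `G`-invariant metrics on `G/H`. -/
abbrev Metrics (F : Type*) [NormedAddCommGroup F] [NormedSpace ℝ F]
    (Q : InnerForm (LieAlg E G)) (H : Subgroup G) [ChartedSpace F H] : Type _ :=
  InvariantMetric H (isotropySpace F Q H)

/-- The space `𝓜(K/H)` of invariant metrics on `K/H`, where `𝔨` is the Lie algebra of `K`. -/
abbrev FiberMetrics (F : Type*) [NormedAddCommGroup F] [NormedSpace ℝ F]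
    (Q : InnerForm (LieAlg E G)) (H : Subgroup G) [ChartedSpace F H]
    (k : Submodule ℝ (LieAlg E G)) : Type _ :=
  InvariantMetric H (fiberSpace F Q H k)

/-- `𝓜_T = {g ∈ 𝓜(G/H) | tr_g T = 1}`. A positive-definite `G`-invariant symmetric tensor field
`T` on `G/H` is the same thing as an `Ad_H`-invariant inner product on `𝔪`. -/
def metricsT (Q : InnerForm (LieAlg E G)) (H : Subgroup G) [ChartedSpace F H]
    (T : Metrics F Q H) : Set (Metrics F Q H) :=
  {g | g.traceForm T.form = 1}

/-- The restriction of `T` to `𝔨 ∩ 𝔪`. -/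
def restrictFiber (Q : InnerForm (LieAlg E G)) (H : Subgroup G) [ChartedSpace F H]
    (T : Metrics F Q H) (k : Submodule ℝ (LieAlg E G)) :
    LinearMap.BilinForm ℝ (fiberSpace F Q H k) :=
  T.form.compl₁₂ (Submodule.inclusion inf_le_right) (Submodule.inclusion inf_le_right)

variable [LieGroup 𝓘(ℝ, E) ∞ G]

/-- `α_𝔨`, the supremum of the scalar curvatures of the metrics `h ∈ 𝓜(K/H)` with
`tr_h T|_{𝔨 ∩ 𝔪} = 1`, as an extended real number. -/
def alphaOf (Q : InnerForm (LieAlg E G)) (H : Subgroup G) [ChartedSpace F H]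
    (T : Metrics F Q H) (k : Submodule ℝ (LieAlg E G)) : EReal :=
  ⨆ (h : FiberMetrics F Q H k) (_ : h.traceForm (restrictFiber Q H T k) = 1),
    (scalarCurvature Q (fiberSpace F Q H k) h.toInnerForm : EReal)

/-- Intermediate subalgebras `𝔥 ⊊ 𝔨 ⊊ 𝔤`, invariant under `Ad_H` (which is automatic if `H` is
connected). -/
def IsIntermediate (F : Type*) [NormedAddCommGroup F] [NormedSpace ℝ F]
    (H : Subgroup G) [ChartedSpace F H] (k : LieSubalgebra ℝ (LieAlg E G)) : Prop :=
  lieOfSubgroup E F H < k.toSubmodule ∧ k.toSubmodule < ⊤ ∧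
    ∀ x ∈ H, ∀ X ∈ k, Ad x X ∈ k

/-- `α_{G/H}`, the supremum of `α_𝔨` over all intermediate subalgebras `𝔨`; it equals `-∞` if there
are none. -/
def alphaGH (Q : InnerForm (LieAlg E G)) (H : Subgroup G) [ChartedSpace F H]
    (T : Metrics F Q H) : EReal :=
  ⨆ (k : LieSubalgebra ℝ (LieAlg E G)) (_ : IsIntermediate F H k), alphaOf Q H T k.toSubmodule

/-- The scalar curvature functional `S` on `𝓜(G/H)`. -/
def scalarCurvatureGH (Q : InnerForm (LieAlg E G)) (H : Subgroup G) [ChartedSpace F H]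
    (g : Metrics F Q H) : ℝ :=
  scalarCurvature Q (isotropySpace F Q H) g.toInnerForm

end Group

end HomogeneousSpace

end

/-! Compactness is tested on an ultrafilter of metrics g with S(g) ≥ a. Each g is diagonalized in a
Q-orthonormal basis f of 𝔪, with eigenvalues x i and inverse eigenvalues w i = 1 / x i. The
constraint tr_g T = 1 reads ∑ T(f i, f i) w i = 1. Orthonormal bases stay in a compact set and T is
positive definite, so the w i are bounded, and both f and w converge along the ultrafilter, to f₀
and y ≥ 0. No direction can shrink to length zero; the only possible degeneration is a blow-up, y j
= 0.

If every y i is positive, the limit is a genuine invariant metric, and it lies in the superlevel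
set. Otherwise the contradiction comes from the formula `frameScalar`, in which S(g) contains the
negative terms -[ijk]² w i w j / (4 w k). A lower bound on S forces [ijk] = 0 in the limit when i, j
survive (y > 0) and k blows up (`structureConst_eq_zero_of_le_frameScalar`). Hence 𝔥 together with
the surviving directions is a subalgebra 𝔨 (`lie_mem_kernelOrthogonal`). It is Ad_H-invariant
because Ad_H respects the eigenspaces of every g, and it is proper on both sides: some direction
blows up, and the trace condition keeps another alive.

The limit also defines a metric h on K/H with tr_h T = 1, and `le_frameScalar_limit` gives S(h) ≥ a.
There the mixed positive terms |[f i, f j]|² y i (i surviving, j blown up) must cancel. Half of the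
cancellation comes from the w i / 2 terms, and half from w j / w k + w k / w j ≥ 2 applied to pairs
of blown-up directions. So a ≤ α_𝔨 ≤ α_{G/H} < a, which is absurd.

The argument needs Q to be ad-invariant and [𝔥, 𝔨] ⊆ 𝔨, whereas the data give invariance under the
group. The passage is the identity d(Ad)(v) = [v, ·], proved in a chart at the identity. -/

namespace HomogeneousSpace

namespace InnerForm

/-! ### Simultaneous diagonalization of two inner products, and formulas in a diagonal basis -/

section Diagonalization

variable {V : Type*} [AddCommGroup V] [Module ℝ V]

/-- The family `f` is orthonormal with respect to `Q`. -/
def Orthonormal {ι : Type*} [DecidableEq ι] (Q : InnerForm V) (f : ι → V) : Prop :=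
  ∀ i j, Q.form (f i) (f j) = if i = j then 1 else 0

/-- The family `f` is orthogonal with respect to `g`, with squared norms `x`. -/
def Diagonal {ι : Type*} [DecidableEq ι] (g : InnerForm V) (f : ι → V) (x : ι → ℝ) : Prop :=
  ∀ i j, g.form (f i) (f j) = if i = j then x i else 0

/-- The inner product space structure defined by `Q`. -/
abbrev core (Q : InnerForm V) : InnerProductSpace.Core ℝ V where
  inner X Y := Q.form X Y
  conj_inner_symm X Y := by simpa using Q.symm Y X
  re_inner_nonneg X := by
    by_cases h : X = 0
    · simp [h]
    · simpa using (Q.pos X h).le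
  add_left := by simp
  smul_left := by simp
  definite X h := by
    by_contra hX
    exact (Q.pos X hX).ne' h

variable [Module.Finite ℝ V]

@[simp]
theorem form_sharp (g : InnerForm V) (φ : Module.Dual ℝ V) (Z : V) :
    g.form (g.sharp φ) Z = φ Z :=
  LinearMap.BilinForm.apply_toDual_symm_apply φ Z

/-- Spectral theorem for the Q-self-adjoint operator A with Q(A X, Y) = g(X, Y). -/
theorem exists_orthonormal_diagonal (Q g : InnerForm V) :
    ∃ (f : Module.Basis (Fin (Module.finrank ℝ V)) ℝ V) (x : Fin (Module.finrank ℝ V) → ℝ),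
      Q.Orthonormal f ∧ g.Diagonal f x ∧ ∀ i, 0 < x i := by
  let := Q.core
  let : NormedAddCommGroup V := InnerProductSpace.Core.toNormedAddCommGroup (𝕜 := ℝ)
  let : InnerProductSpace ℝ V := InnerProductSpace.ofCore Q.core.toCore
  let A : V →ₗ[ℝ] V := Q.sharp.toLinearMap ∘ₗ g.form
  have hinner : ∀ X Y : V, inner ℝ X Y = Q.form X Y := fun _ _ => rfl
  have hA : A.IsSymmetric := fun X Y => by
    rw [hinner, hinner, Q.symm X]
    simp [A, g.symm X Y]
  let b := hA.eigenvectorBasis rfl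
  have hb : ∀ i j, inner ℝ (b i) (b j) = if i = j then (1 : ℝ) else 0 :=
    orthonormal_iff_ite.mp b.orthonormal
  have hg : ∀ i j, g.form (b i) (b j) = if i = j then hA.eigenvalues rfl i else 0 := fun i j => by
    have h1 : g.form (b i) (b j) = Q.form (A (b i)) (b j) := by simp [A]
    have h2 : A (b i) = hA.eigenvalues rfl i • b i := hA.apply_eigenvectorBasis rfl i
    rw [h1, h2, map_smul, LinearMap.smul_apply, ← hinner, hb]
    simp
  refine ⟨b.toBasis, hA.eigenvalues rfl, fun i j => ?_, fun i j => ?_, fun i => ?_⟩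
  · rw [hA.eigenvectorBasis rfl |>.coe_toBasis]
    exact hb i j
  · rw [hA.eigenvectorBasis rfl |>.coe_toBasis]
    exact hg i j
  · have h := g.pos (b i) (b.orthonormal.ne_zero i)
    rwa [hg, if_pos rfl] at h

end Diagonalization

section Basis

variable {V : Type*} [AddCommGroup V] [Module ℝ V] {ι : Type*} [DecidableEq ι]

theorem Diagonal.pos {g : InnerForm V} {f : Module.Basis ι ℝ V} {x : ι → ℝ}
    (hg : g.Diagonal f x) (i : ι) : 0 < x i := by
  simpa [hg i i] using g.pos (f i) (f.ne_zero i)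

variable [Fintype ι]

theorem Diagonal.form_basis {g : InnerForm V} {f : Module.Basis ι ℝ V} {x : ι → ℝ}
    (hg : g.Diagonal f x) (X : V) (i : ι) : g.form X (f i) = x i * f.repr X i := by
  conv_lhs => rw [← f.sum_repr X]
  simp [-Module.Basis.sum_repr, hg _ _, mul_comm]

theorem Diagonal.form_eq_sum {g : InnerForm V} {f : Module.Basis ι ℝ V} {x : ι → ℝ}
    (hg : g.Diagonal f x) (X Y : V) : g.form X Y = ∑ i, x i * f.repr X i * f.repr Y i := by
  conv_lhs => rw [← f.sum_repr Y]
  simp [-Module.Basis.sum_repr, hg.form_basis, mul_comm]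

theorem Orthonormal.form_basis {Q : InnerForm V} {f : Module.Basis ι ℝ V}
    (hQ : Q.Orthonormal f) (X : V) (i : ι) : Q.form X (f i) = f.repr X i := by
  conv_lhs => rw [← f.sum_repr X]
  simp [-Module.Basis.sum_repr, hQ _ _]

theorem Orthonormal.sum_smul {Q : InnerForm V} {f : Module.Basis ι ℝ V}
    (hQ : Q.Orthonormal f) (X : V) : ∑ i, Q.form X (f i) • f i = X := by
  simp_rw [hQ.form_basis, f.sum_repr]

theorem Orthonormal.form_eq_sum {Q : InnerForm V} {f : Module.Basis ι ℝ V}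
    (hQ : Q.Orthonormal f) (X Y : V) :
    Q.form X Y = ∑ i, Q.form X (f i) * Q.form Y (f i) := by
  conv_lhs => rw [← hQ.sum_smul Y]
  simp [mul_comm]

theorem Orthonormal.trace_eq {Q : InnerForm V} {f : Module.Basis ι ℝ V}
    (hQ : Q.Orthonormal f) (A : V →ₗ[ℝ] V) :
    LinearMap.trace ℝ V A = ∑ i, Q.form (A (f i)) (f i) := by
  rw [LinearMap.trace_eq_matrix_trace ℝ f]
  simp [Matrix.trace, LinearMap.toMatrix_apply, hQ.form_basis]

theorem Diagonal.traceForm_eq [Module.Finite ℝ V] {g : InnerForm V} {f : Module.Basis ι ℝ V}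
    {x : ι → ℝ} (hg : g.Diagonal f x) (A : LinearMap.BilinForm ℝ V) :
    g.traceForm A = ∑ i, A (f i) (f i) * (x i)⁻¹ := by
  rw [traceForm, LinearMap.trace_eq_matrix_trace ℝ f]
  refine Finset.sum_congr rfl fun i _ => ?_
  have h := hg.form_basis (g.sharp (A (f i))) i
  rw [form_sharp] at h
  rw [h, mul_comm, inv_mul_cancel_left₀ (hg.pos i).ne']
  simp [LinearMap.toMatrix_apply]

end Basis

section Proj

variable {L : Type*} [AddCommGroup L] [Module ℝ L] [Module.Finite ℝ L]

theorem form_proj (Q : InnerForm L) (p : Submodule ℝ L) (X : L) (Y : p) :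
    (Q.restrict p).form (Q.proj p X) Y = Q.form X (Y : L) := by
  simp [proj]

end Proj

end InnerForm

end HomogeneousSpace

namespace HomogeneousSpace

open InnerForm

/-! ### Scalar curvature in terms of structure constants -/

section CurvatureFormula

variable {L : Type*} [LieRing L] [LieAlgebra ℝ L]

/-- The inner product `Q` is invariant under the adjoint representation of the Lie algebra. -/
def InnerForm.AdInvariant (Q : InnerForm L) : Prop :=
  ∀ X Y Z : L, Q.form ⁅X, Y⁆ Z + Q.form Y ⁅X, Z⁆ = 0

/-- The structure constants of a family of vectors with respect to `Q`. -/
def structureConst {ι : Type*} (Q : InnerForm L) (f : ι → L) (i j k : ι) : ℝ :=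
  Q.form ⁅f i, f j⁆ (f k)

variable {ι : Type*} {Q : InnerForm L}

theorem InnerForm.AdInvariant.form_lie (hQ : Q.AdInvariant) (X Y Z : L) :
    Q.form ⁅X, Y⁆ Z = Q.form X ⁅Y, Z⁆ := by
  have h := hQ Y X Z
  rw [← lie_skew, map_neg, LinearMap.neg_apply]
  linarith

theorem structureConst_swap_left (f : ι → L) (i j k : ι) :
    structureConst Q f j i k = -structureConst Q f i j k := by
  rw [structureConst, structureConst, ← lie_skew, map_neg, LinearMap.neg_apply]

/-- With `structureConst_swap_left` this makes the structure constants totally antisymmetric, so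
their squares depend only on the unordered triple. -/
theorem InnerForm.AdInvariant.structureConst_rotate (hQ : Q.AdInvariant) (f : ι → L) (i j k : ι) :
    structureConst Q f j k i = structureConst Q f i j k := by
  rw [structureConst, structureConst, hQ.form_lie (f i), Q.symm]

theorem InnerForm.AdInvariant.structureConst_swap_right (hQ : Q.AdInvariant) (f : ι → L)
    (i j k : ι) : structureConst Q f i k j = -structureConst Q f i j k := by
  rw [← hQ.structureConst_rotate, ← hQ.structureConst_rotate, structureConst_swap_left,
    ← hQ.structureConst_rotate]

theorem InnerForm.AdInvariant.structureConst_self (hQ : Q.AdInvariant) (f : ι → L)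
    (i j : ι) : structureConst Q f i j i = 0 := by
  rw [← hQ.structureConst_rotate, ← hQ.structureConst_rotate, structureConst, lie_self, map_zero,
    LinearMap.zero_apply]

/-- The scalar curvature of the metric with inverse eigenvalues `w` in the `Q`-orthonormal
frame `f`. -/
noncomputable def frameScalar [Fintype ι] (Q : InnerForm L) (f : ι → L) (w : ι → ℝ) : ℝ :=
  ∑ i, ∑ j, Q.form ⁅f i, f j⁆ ⁅f i, f j⁆ * w i
    - ∑ i, ∑ j, ∑ k, structureConst Q f i j k ^ 2 * (w i / 2 + w i * w j / w k / 4)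

variable [Fintype ι]

theorem InnerForm.AdInvariant.sum_structureConst_sq_rotate (hQ : Q.AdInvariant) (f : ι → L)
    (F : ι → ι → ι → ℝ) :
    ∑ i, ∑ j, ∑ k, structureConst Q f i j k ^ 2 * F i j k
      = ∑ i, ∑ j, ∑ k, structureConst Q f i j k ^ 2 * F j k i := by
  conv_rhs =>
    rw [Finset.sum_comm]
    enter [2, j]
    rw [Finset.sum_comm]
    enter [2, k, 2, i]
    rw [← hQ.structureConst_rotate f i j k]

variable [DecidableEq ι] [Module.Finite ℝ L]
  {p : Submodule ℝ L} {f : Module.Basis ι ℝ p} {g : InnerForm p} {x : ι → ℝ}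

theorem bracketP_basis (hf : (Q.restrict p).Orthonormal f) (i j : ι) :
    bracketP Q p (f i) (f j) = ∑ k, structureConst Q (fun i => (f i : L)) i j k • f k := by
  rw [← hf.sum_smul (bracketP Q p (f i) (f j))]
  refine Finset.sum_congr rfl fun k _ => ?_
  rw [structureConst, ← form_proj]
  rfl

/-- Koszul formula: total antisymmetry turns its three bracket terms into multiples of one structure
constant, with factors x k, x j and -x i. -/
theorem leviCivita_basis (hQ : Q.AdInvariant) (hf : (Q.restrict p).Orthonormal f)
    (hg : g.Diagonal f x) (i j : ι) :
    leviCivita Q p g (f i) (f j) =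
      ∑ k, (structureConst Q (fun i => (f i : L)) i j k * (x k + x j - x i) / x k / 2) • f k := by
  rw [← f.sum_repr (leviCivita Q p g (f i) (f j))]
  refine Finset.sum_congr rfl fun k _ => ?_
  congr 1
  have hk := (hg.pos k).ne'
  have h := hg.form_basis (leviCivita Q p g (f i) (f j)) k
  have h1 : ∀ i j k, g.form (bracketP Q p (f i) (f j)) (f k) =
      structureConst Q (fun i => (f i : L)) i j k * x k := fun i j k => by
    rw [bracketP_basis hf]
    simp [hg _ _]
  have h2 : g.form (leviCivita Q p g (f i) (f j)) (f k) =
      structureConst Q (fun i => (f i : L)) i j k * (x k + x j - x i) / 2 := by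
    simp only [leviCivita, LinearMap.mk₂_apply, form_sharp]
    simp only [LinearMap.smul_apply, LinearMap.add_apply, LinearMap.comp_apply,
      LinearMap.flip_apply, smul_eq_mul]
    rw [g.symm (f j), g.symm (f i), h1, h1, h1, ← hQ.structureConst_rotate _ k i j,
      structureConst_swap_left _ j k i, hQ.structureConst_rotate _ i j k]
    ring
  rw [h2] at h
  field_simp
  linarith

theorem form_leviCivita_comp (hQ : Q.AdInvariant) (hf : (Q.restrict p).Orthonormal f)
    (hg : g.Diagonal f x) (l i j k : ι) :
    (Q.restrict p).form (leviCivita Q p g (f l) (leviCivita Q p g (f i) (f j))) (f k) =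
      ∑ m, (structureConst Q (fun i => (f i : L)) i j m * (x m + x j - x i) / x m / 2) *
        (structureConst Q (fun i => (f i : L)) l m k * (x k + x m - x l) / x k / 2) := by
  rw [leviCivita_basis hQ hf hg i j]
  simp only [map_sum, map_smul, LinearMap.sum_apply, LinearMap.smul_apply, smul_eq_mul]
  refine Finset.sum_congr rfl fun m _ => ?_
  rw [leviCivita_basis hQ hf hg l m]
  simp [hf _ _]

/-- Moving ad(f j) across Q gives -|[f i, f j]_𝔥|², expressed as the squared norm of the p-component
minus that of the whole bracket. -/
theorem form_isotropyP (hQ : Q.AdInvariant) (hf : (Q.restrict p).Orthonormal f) (i j : ι) :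
    (Q.restrict p).form (isotropyP Q p (f i) (f j) (f j)) (f i) =
      ∑ k, structureConst Q (fun i => (f i : L)) i j k ^ 2
        - Q.form ⁅(f i : L), (f j : L)⁆ ⁅(f i : L), (f j : L)⁆ := by
  have h : (Q.restrict p).form (isotropyP Q p (f i) (f j) (f j)) (f i) =
      Q.form ⁅⁅(f i : L), (f j : L)⁆ - (bracketP Q p (f i) (f j) : L), (f j : L)⁆ (f i) :=
    form_proj Q p _ (f i)
  have h2 : Q.form (∑ k, structureConst Q (fun i => (f i : L)) i j k • f k : p)
      ⁅(f i : L), (f j : L)⁆ = ∑ k, structureConst Q (fun i => (f i : L)) i j k ^ 2 := by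
    rw [Q.symm]
    simp [sq, structureConst]
  rw [h, hQ.form_lie, ← lie_skew (f j : L) (f i : L), map_neg, map_sub, LinearMap.sub_apply,
    bracketP_basis hf, h2]
  ring

theorem ricci_basis (hQ : Q.AdInvariant) (hf : (Q.restrict p).Orthonormal f)
    (hg : g.Diagonal f x) (j : ι) :
    ricci Q p g (f j) (f j) =
      ∑ i, (Q.form ⁅(f i : L), (f j : L)⁆ ⁅(f i : L), (f j : L)⁆ +
        ∑ k, structureConst Q (fun i => (f i : L)) i j k ^ 2 *
          (-((x k + x j - x i) * (x i + x k - x j) / (x i * x k) / 4)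
            + (x i + x j - x k) / x i / 2 - 1)) := by
  have h0 : ricci Q p g (f j) (f j) =
      LinearMap.trace ℝ p (((curvature Q p g).flip (f j)).flip (f j)) := rfl
  rw [h0, hf.trace_eq]
  refine Finset.sum_congr rfl fun i _ => ?_
  have h1 : (((curvature Q p g).flip (f j)).flip (f j)) (f i) =
      leviCivita Q p g (f i) (leviCivita Q p g (f j) (f j))
      - leviCivita Q p g (f j) (leviCivita Q p g (f i) (f j))
      - leviCivita Q p g (bracketP Q p (f i) (f j)) (f j) - isotropyP Q p (f i) (f j) (f j) := rfl
  have h2 : (Q.restrict p).form (leviCivita Q p g (bracketP Q p (f i) (f j)) (f j)) (f i) =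
      ∑ k, structureConst Q (fun i => (f i : L)) i j k *
        (structureConst Q (fun i => (f i : L)) k j i * (x i + x j - x k) / x i / 2) := by
    rw [bracketP_basis hf]
    simp only [map_sum, map_smul, LinearMap.sum_apply, LinearMap.smul_apply, smul_eq_mul]
    refine Finset.sum_congr rfl fun m _ => ?_
    rw [leviCivita_basis hQ hf hg]
    simp [hf _ _]
  rw [h1]
  simp only [map_sub, LinearMap.sub_apply]
  rw [form_isotropyP hQ hf, h2, form_leviCivita_comp hQ hf hg, form_leviCivita_comp hQ hf hg]
  -- The term Λ(f i)Λ(f j)f j has no f i component, since the structure constants (i, m, i) vanish.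
  simp only [hQ.structureConst_self, zero_mul, mul_zero, zero_div, Finset.sum_const_zero]
  rw [sub_sub_eq_add_sub, add_comm, add_sub_assoc, zero_sub]
  congr 1
  rw [← Finset.sum_neg_distrib, ← Finset.sum_sub_distrib, ← Finset.sum_sub_distrib]
  refine Finset.sum_congr rfl fun k _ => ?_
  rw [structureConst_swap_left _ j k i, hQ.structureConst_rotate _ i j k]
  have := (hg.pos k).ne'
  have := (hg.pos i).ne'
  field_simp
  ring

/-- After tracing the Ricci formula, terms differing by a cyclic relabelling have equal sums: the
quotients add up to 1/4 + 1/4 - 3/4 = -1/4, the linear terms to 1/2 - 1/2 - 1/2 = -1/2. Only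
brackets of vectors in p occur, so the same formula serves G/H and every K/H. -/
theorem scalarCurvature_eq_frameScalar (hQ : Q.AdInvariant) (hf : (Q.restrict p).Orthonormal f)
    (hg : g.Diagonal f x) :
    scalarCurvature Q p g = frameScalar Q (fun i => (f i : L)) (fun i => (x i)⁻¹) := by
  rw [scalarCurvature, hg.traceForm_eq]
  simp_rw [ricci_basis hQ hf hg]
  have hx : ∀ i, x i ≠ 0 := fun i => (hg.pos i).ne'
  set w : ι → ℝ := fun i => (x i)⁻¹ with hw
  set s := structureConst Q (fun i => (f i : L)) with hs
  have hF1 := hQ.sum_structureConst_sq_rotate (fun i => (f i : L)) (fun i j k => w i * w j / w k)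
  have hF2 := hQ.sum_structureConst_sq_rotate (fun i => (f i : L)) (fun i j k => w j * w k / w i)
  have hW1 := hQ.sum_structureConst_sq_rotate (fun i => (f i : L)) (fun i _ _ => w i)
  have hW2 := hQ.sum_structureConst_sq_rotate (fun i => (f i : L)) (fun _ j _ => w j)
  rw [← hs] at hF1 hF2 hW1 hW2
  have h1 : ∑ j, (∑ i, (Q.form ⁅(f i : L), (f j : L)⁆ ⁅(f i : L), (f j : L)⁆ +
        ∑ k, s i j k ^ 2 * (-((x k + x j - x i) * (x i + x k - x j) / (x i * x k) / 4)
            + (x i + x j - x k) / x i / 2 - 1))) * (x j)⁻¹ =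
      ∑ i, ∑ j, Q.form ⁅(f i : L), (f j : L)⁆ ⁅(f i : L), (f j : L)⁆ * w i +
        ∑ i, ∑ j, ∑ k, (s i j k ^ 2 * (w j * w k / w i) / 4 + s i j k ^ 2 * (w k * w i / w j) / 4
          - s i j k ^ 2 * (w i * w j / w k) * (3 / 4) + s i j k ^ 2 * w i / 2
          - s i j k ^ 2 * w j / 2 - s i j k ^ 2 * w k / 2) := by
    rw [Finset.sum_comm (f := fun i j => ∑ k, (_ : ℝ)), ← Finset.sum_add_distrib]
    refine Finset.sum_congr rfl fun j _ => ?_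
    rw [Finset.sum_mul, ← Finset.sum_add_distrib]
    refine Finset.sum_congr rfl fun i _ => ?_
    rw [← lie_skew (f i : L) (f j : L), map_neg, map_neg, LinearMap.neg_apply, neg_neg, add_mul,
      Finset.sum_mul]
    congr 1
    refine Finset.sum_congr rfl fun k _ => ?_
    have h1 := hx i
    have h2 := hx j
    have h3 := hx k
    simp only [hw]
    field_simp
    ring
  rw [h1, frameScalar, ← hs, sub_eq_add_neg]
  congr 1
  simp only [mul_add, Finset.sum_add_distrib, Finset.sum_sub_distrib, ← Finset.sum_div,
    ← Finset.sum_mul, ← mul_div_assoc] at hF1 hF2 hW1 hW2 ⊢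
  linarith

end CurvatureFormula

end HomogeneousSpace

namespace HomogeneousSpace

open Filter Topology Set VectorField

/-! ### Second-order calculus of a local group law -/

section Calculus

variable {E : Type*} [NormedAddCommGroup E] [NormedSpace ℝ E]

/-- If `c` is the conjugation of a local product `m` with unit `e`, then the derivative of the
adjoint representation is the antisymmetrization of the second derivative of `m`. -/
theorem hasFDerivAt_partial_conj {m c : E × E → E} {e : E}
    (hm : ContDiffAt ℝ 2 m (e, e)) (hc : ContDiffAt ℝ 2 c (e, e))
    (hem : ∀ᶠ a in 𝓝 e, m (a, e) = a) (hce : ∀ᶠ a in 𝓝 e, c (a, e) = e)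
    (hec : ∀ᶠ b in 𝓝 e, c (e, b) = b)
    (h : ∀ᶠ q in 𝓝 (e, e), m q = m (c q, q.1)) (w v : E) :
    HasFDerivAt (fun a => fderiv ℝ c (a, e) (0, w))
      (((ContinuousLinearMap.apply ℝ E ((0 : E), w)).comp (fderiv ℝ (fderiv ℝ c) (e, e))).comp
        (ContinuousLinearMap.inl ℝ E E)) e ∧
    fderiv ℝ (fderiv ℝ c) (e, e) (v, 0) (0, w) =
      fderiv ℝ (fderiv ℝ m) (e, e) (v, 0) (0, w) - fderiv ℝ (fderiv ℝ m) (e, e) (w, 0) (0, v) := by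
  have hm1 : ∀ᶠ q in 𝓝 (e, e), DifferentiableAt ℝ m q :=
    (hm.eventually (by simp)).mono fun q hq => hq.differentiableAt (by simp)
  have hc1 : ∀ᶠ q in 𝓝 (e, e), DifferentiableAt ℝ c q :=
    (hc.eventually (by simp)).mono fun q hq => hq.differentiableAt (by simp)
  have hm2 : HasFDerivAt (fderiv ℝ m) (fderiv ℝ (fderiv ℝ m) (e, e)) (e, e) :=
    ((hm.fderiv_right (m := 1) (by norm_num)).differentiableAt (by simp)).hasFDerivAt
  have hc2 : HasFDerivAt (fderiv ℝ c) (fderiv ℝ (fderiv ℝ c) (e, e)) (e, e) :=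
    ((hc.fderiv_right (m := 1) (by norm_num)).differentiableAt (by simp)).hasFDerivAt
  have hinl : HasFDerivAt (fun a : E => (a, e)) (ContinuousLinearMap.inl ℝ E E) e :=
    hasFDerivAt_prodMk_left e e
  have hinr : HasFDerivAt (fun a : E => (e, a)) (ContinuousLinearMap.inr ℝ E E) e :=
    hasFDerivAt_prodMk_right e e
  have htl : Tendsto (fun a : E => (a, e)) (𝓝 e) (𝓝 (e, e)) := hinl.continuousAt
  have htr : Tendsto (fun a : E => (e, a)) (𝓝 e) (𝓝 (e, e)) := hinr.continuousAt
  have hC : HasFDerivAt (fun a => fderiv ℝ c (a, e) (0, w))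
      (((ContinuousLinearMap.apply ℝ E ((0 : E), w)).comp (fderiv ℝ (fderiv ℝ c) (e, e))).comp
        (ContinuousLinearMap.inl ℝ E E)) e :=
    (((ContinuousLinearMap.apply ℝ E ((0 : E), w)).hasFDerivAt).comp (e, e) hc2).comp
      (f := fun a : E => (a, e)) e hinl
  refine ⟨hC, ?_⟩
  have hM : HasFDerivAt (fun a => fderiv ℝ m (a, e) (0, w))
      (((ContinuousLinearMap.apply ℝ E ((0 : E), w)).comp (fderiv ℝ (fderiv ℝ m) (e, e))).comp
        (ContinuousLinearMap.inl ℝ E E)) e :=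
    (((ContinuousLinearMap.apply ℝ E ((0 : E), w)).hasFDerivAt).comp (e, e) hm2).comp
      (f := fun a : E => (a, e)) e hinl
  -- The identity ab = (aba⁻¹)a, differentiated in b at b = e. Differentiating the result once more
  -- in a at e gives the claim, as c(e, ·) and m(·, e) are locally the identity.
  have hchain : (fun a => fderiv ℝ m (a, e) (0, w)) =ᶠ[𝓝 e]
      fun a => fderiv ℝ m (e, a) (fderiv ℝ c (a, e) (0, w), 0) := by
    filter_upwards [htl.eventually h.eventually_nhds, hce, htr.eventually hm1,
      htl.eventually hc1] with a h1 h2 h3 h4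
    have h5 : fderiv ℝ m (a, e) = fderiv ℝ (fun q : E × E => m (c q, q.1)) (a, e) :=
      EventuallyEq.fderiv_eq h1
    have h6 : HasFDerivAt (fun q : E × E => m (c q, q.1))
        ((fderiv ℝ m (e, a)).comp ((fderiv ℝ c (a, e)).prod (ContinuousLinearMap.fst ℝ E E)))
        (a, e) := by
      have h7 : HasFDerivAt m (fderiv ℝ m (e, a)) (c (a, e), (a, e).1) := by
        rw [h2]
        exact h3.hasFDerivAt
      exact h7.comp (a, e) (h4.hasFDerivAt.prodMk hasFDerivAt_fst)
    rw [h5, h6.fderiv]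
    simp
  have hR : HasFDerivAt (fun a => fderiv ℝ m (e, a) (fderiv ℝ c (a, e) (0, w), 0)) _ e :=
    (hm2.comp
          (f := fun a : E => (e, a)) e hinr).clm_apply (hC.prodMk (hasFDerivAt_const (0 : E) e))
  have hEq := (hM.congr_of_eventuallyEq hchain.symm).unique hR
  have hEq' := congrArg (fun A => A v) hEq
  have hcw : fderiv ℝ c (e, e) (0, w) = w := by
    have h1 : HasFDerivAt (fun b => c (e, b)) ((fderiv ℝ c (e, e)).comp
        (ContinuousLinearMap.inr ℝ E E)) e := hc1.self_of_nhds.hasFDerivAt.comp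
          (f := fun a : E => (e, a)) e hinr
    have h2 : HasFDerivAt (fun b => c (e, b)) (ContinuousLinearMap.id ℝ E) e :=
      (hasFDerivAt_id e).congr_of_eventuallyEq hec
    simpa using congrArg (fun A => A w) (h1.unique h2)
  have hmw : ∀ u, fderiv ℝ m (e, e) (u, 0) = u := fun u => by
    have h1 : HasFDerivAt (fun b => m (b, e)) ((fderiv ℝ m (e, e)).comp
        (ContinuousLinearMap.inl ℝ E E)) e := hm1.self_of_nhds.hasFDerivAt.comp
      (f := fun a : E => (a, e)) e hinl
    have h2 : HasFDerivAt (fun b => m (b, e)) (ContinuousLinearMap.id ℝ E) e :=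
      (hasFDerivAt_id e).congr_of_eventuallyEq hem
    simpa using congrArg (fun A => A u) (h1.unique h2)
  have hsymm : fderiv ℝ (fderiv ℝ m) (e, e) (0, v) (w, 0) =
      fderiv ℝ (fderiv ℝ m) (e, e) (w, 0) (0, v) :=
    (hm.isSymmSndFDerivAt (by simp)).eq _ _
  simp [hcw, hmw, hsymm] at hEq'
  rw [hEq']
  abel

end Calculus

/-! ### The Lie bracket read in the chart at the identity -/

section Chart

variable {E : Type*} [NormedAddCommGroup E] [NormedSpace ℝ E]
  {G : Type*} [TopologicalSpace G] [ChartedSpace E G] [Group G]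

/-- The multiplication of `G` in the chart at the identity. -/
noncomputable def chartMul (E : Type*) [NormedAddCommGroup E] [NormedSpace ℝ E]
    (G : Type*) [TopologicalSpace G] [ChartedSpace E G] [Group G] (q : E × E) : E :=
  extChartAt 𝓘(ℝ, E) (1 : G)
    ((extChartAt 𝓘(ℝ, E) (1 : G)).symm q.1 * (extChartAt 𝓘(ℝ, E) (1 : G)).symm q.2)

/-- The conjugation of `G` in the chart at the identity. -/
noncomputable def chartConj (E : Type*) [NormedAddCommGroup E] [NormedSpace ℝ E]
    (G : Type*) [TopologicalSpace G] [ChartedSpace E G] [Group G] (q : E × E) : E :=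
  extChartAt 𝓘(ℝ, E) (1 : G)
    ((extChartAt 𝓘(ℝ, E) (1 : G)).symm q.1 * (extChartAt 𝓘(ℝ, E) (1 : G)).symm q.2
      * ((extChartAt 𝓘(ℝ, E) (1 : G)).symm q.1)⁻¹)

variable [LieGroup 𝓘(ℝ, E) ∞ G]

local notation "φ" => extChartAt 𝓘(ℝ, E) (1 : G)

theorem contMDiffAt_extChartAt_symm_one :
    ContMDiffAt 𝓘(ℝ, E) 𝓘(ℝ, E) ∞ (φ).symm (φ 1) :=
  (contMDiffOn_extChartAt_symm (1 : G)).contMDiffAt (extChartAt_target_mem_nhds (1 : G))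

theorem contDiffAt_chartMul : ContDiffAt ℝ ∞ (chartMul E G) (φ 1, φ 1) := by
  rw [← contMDiffAt_iff_contDiffAt]
  have h1 : ContMDiffAt 𝓘(ℝ, E × E) 𝓘(ℝ, E) ∞
      (fun q : E × E => (φ).symm q.1) (φ 1, φ 1) :=
    contMDiffAt_extChartAt_symm_one.comp (φ 1, φ 1) contDiff_fst.contMDiff.contMDiffAt
  have h2 : ContMDiffAt 𝓘(ℝ, E × E) 𝓘(ℝ, E) ∞
      (fun q : E × E => (φ).symm q.2) (φ 1, φ 1) :=
    contMDiffAt_extChartAt_symm_one.comp (φ 1, φ 1) contDiff_snd.contMDiff.contMDiffAt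
  have h3 : ContMDiffAt 𝓘(ℝ, E) 𝓘(ℝ, E) ∞ (φ) ((φ).symm (φ 1) * (φ).symm (φ 1)) := by
    rw [extChartAt_to_inv, mul_one]
    exact contMDiffAt_extChartAt
  exact h3.comp (φ 1, φ 1) (h1.mul h2)

theorem contDiffAt_chartConj : ContDiffAt ℝ ∞ (chartConj E G) (φ 1, φ 1) := by
  rw [← contMDiffAt_iff_contDiffAt]
  have h1 : ContMDiffAt 𝓘(ℝ, E × E) 𝓘(ℝ, E) ∞
      (fun q : E × E => (φ).symm q.1) (φ 1, φ 1) :=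
    contMDiffAt_extChartAt_symm_one.comp (φ 1, φ 1) contDiff_fst.contMDiff.contMDiffAt
  have h2 : ContMDiffAt 𝓘(ℝ, E × E) 𝓘(ℝ, E) ∞
      (fun q : E × E => (φ).symm q.2) (φ 1, φ 1) :=
    contMDiffAt_extChartAt_symm_one.comp (φ 1, φ 1) contDiff_snd.contMDiff.contMDiffAt
  have h3 : ContMDiffAt 𝓘(ℝ, E) 𝓘(ℝ, E) ∞ (φ)
      ((φ).symm (φ 1) * (φ).symm (φ 1) * ((φ).symm (φ 1))⁻¹) := by
    rw [extChartAt_to_inv, mul_one, mul_inv_cancel]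
    exact contMDiffAt_extChartAt
  exact h3.comp (φ 1, φ 1) ((h1.mul h2).mul h1.inv)

theorem eventually_extChartAt_symm_conj_mem :
    ∀ᶠ q : E × E in 𝓝 (φ 1, φ 1),
      (φ).symm q.1 * (φ).symm q.2 * ((φ).symm q.1)⁻¹ ∈ (φ).source := by
  have : IsTopologicalGroup G := topologicalGroup_of_lieGroup 𝓘(ℝ, E) ∞
  have h1 : ContinuousAt (fun q : E × E => (φ).symm q.1) (φ 1, φ 1) :=
    (continuousAt_extChartAt_symm (1 : G)).comp (f := Prod.fst) (x := (φ 1, φ 1)) continuousAt_fst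
  have h2 : ContinuousAt (fun q : E × E => (φ).symm q.2) (φ 1, φ 1) :=
    (continuousAt_extChartAt_symm (1 : G)).comp (f := Prod.snd) (x := (φ 1, φ 1)) continuousAt_snd
  have h : ContinuousAt (fun q : E × E => (φ).symm q.1 * (φ).symm q.2 * ((φ).symm q.1)⁻¹)
      (φ 1, φ 1) := (h1.mul h2).mul h1.inv
  refine h.eventually_mem ?_
  simpa using extChartAt_source_mem_nhds (I := 𝓘(ℝ, E)) (1 : G)

theorem mfderiv_chart_comp {f : G → G} (hf : MDifferentiableAt 𝓘(ℝ, E) 𝓘(ℝ, E) f 1) {y : G}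
    (hy : f 1 = y) (hys : y ∈ (φ).source) (v : E) :
    mfderiv 𝓘(ℝ, E) 𝓘(ℝ, E) (φ) y (mfderiv 𝓘(ℝ, E) 𝓘(ℝ, E) f 1 v : E) =
      fderiv ℝ (fun b => φ (f ((φ).symm b))) (φ 1) v := by
  subst hy
  have : IsManifold 𝓘(ℝ, E) 1 G := IsManifold.of_le (n := ∞) (by simp)
  have h1 : MDifferentiableAt 𝓘(ℝ, E) 𝓘(ℝ, E) (φ) (f 1) :=
    mdifferentiableAt_extChartAt (by simpa using hys)
  have h2 := mfderiv_comp (1 : G) h1 hf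
  have h3 : fderivWithin ℝ (fun b => φ (f ((φ).symm b))) (range 𝓘(ℝ, E)) (φ 1) v =
      mfderiv 𝓘(ℝ, E) 𝓘(ℝ, E) ((φ) ∘ f) 1 v :=
    (congrArg (fun A : E →L[ℝ] E => A v) (h1.comp 1 hf).mfderiv).symm
  rw [modelWithCornersSelf_coe, range_id, fderivWithin_univ] at h3
  exact (h3.trans (congrArg (fun A : E →L[ℝ] E => A v) h2)).symm

omit [LieGroup 𝓘(ℝ, E) ∞ G] in
theorem fderiv_chartMul_apply {a : E} (ha : DifferentiableAt ℝ (chartMul E G) (a, φ 1)) (v : E) :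
    fderiv ℝ (chartMul E G) (a, φ 1) (0, v) =
      fderiv ℝ (fun b => φ ((φ).symm a * (φ).symm b)) (φ 1) v := by
  have h := (ha.hasFDerivAt.comp (φ 1) (hasFDerivAt_prodMk_right a (φ 1))).fderiv
  have h2 : chartMul E G ∘ (fun b => (a, b)) = fun b => φ ((φ).symm a * (φ).symm b) := rfl
  rw [h2] at h
  rw [h]
  simp

/-- A left-invariant field is the derivative of left translation applied to v; in the chart this is
the partial derivative of the product in its second argument. -/
theorem mpullback_invariantVectorField_chart (v : LieAlg E G) :
    (fun a => mpullbackWithin 𝓘(ℝ, E) 𝓘(ℝ, E) (φ).symm (mulInvariantVectorField v)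
      (range 𝓘(ℝ, E)) a) =ᶠ[𝓝 (φ 1)] fun a => fderiv ℝ (chartMul E G) (a, φ 1) (0, v) := by
  have : IsManifold 𝓘(ℝ, E) 1 G := IsManifold.of_le (n := ∞) (by simp)
  have htl : Tendsto (fun a : E => (a, φ 1)) (𝓝 (φ 1)) (𝓝 (φ 1, φ 1)) :=
    (hasFDerivAt_prodMk_left (𝕜 := ℝ) (φ 1) (φ 1)).continuousAt
  have hd : ∀ᶠ q in 𝓝 (φ 1, φ 1), DifferentiableAt ℝ (chartMul E G) q :=
    ((contDiffAt_chartMul (G := G).of_le (m := 2) (by norm_cast)).eventually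
      (by simp)).mono fun q hq => hq.differentiableAt (by simp)
  filter_upwards [extChartAt_target_mem_nhds (I := 𝓘(ℝ, E)) (1 : G), htl.eventually hd]
    with a ha hda
  have hinv : (mfderivWithin 𝓘(ℝ, E) 𝓘(ℝ, E) (φ).symm (range 𝓘(ℝ, E)) a).inverse =
      mfderiv 𝓘(ℝ, E) 𝓘(ℝ, E) (φ) ((φ).symm a) :=
    ContinuousLinearMap.inverse_eq (mfderivWithin_extChartAt_symm_comp_mfderiv_extChartAt ha)
      (mfderiv_extChartAt_comp_mfderivWithin_extChartAt_symm ha)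
  refine (congrArg (fun A : E →L[ℝ] E => A (mulInvariantVectorField v ((φ).symm a))) hinv).trans ?_
  refine Eq.trans ?_ (fderiv_chartMul_apply hda v).symm
  exact mfderiv_chart_comp (f := fun y : G => (φ).symm a * y)
    ((contMDiff_mul_left (n := ∞)).mdifferentiable (by simp) 1) (mul_one _) ((φ).map_target ha) v

/-- The bracket is that of left-invariant fields at 1. In the chart these are a ↦ D₂m(a, e)v, with
value v at a = e, so the bracket antisymmetrizes the mixed second derivative. -/
theorem bracket_eq_chart (v w : LieAlg E G) :
    ⁅v, w⁆ = fderiv ℝ (fderiv ℝ (chartMul E G)) (φ 1, φ 1) (v, 0) (0, w)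
      - fderiv ℝ (fderiv ℝ (chartMul E G)) (φ 1, φ 1) (w, 0) (0, v) := by
  have hM : IsManifold 𝓘(ℝ, E) 1 G := IsManifold.of_le (n := ∞) (by simp)
  have hm : ContDiffAt ℝ 2 (chartMul E G) (φ 1, φ 1) :=
    contDiffAt_chartMul.of_le (by norm_cast)
  have hm2 : HasFDerivAt (fderiv ℝ (chartMul E G))
      (fderiv ℝ (fderiv ℝ (chartMul E G)) (φ 1, φ 1)) (φ 1, φ 1) :=
    ((hm.fderiv_right (m := 1) (by norm_num)).differentiableAt (by simp)).hasFDerivAt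
  have hd : ∀ w : E, fderiv ℝ (fun a => fderiv ℝ (chartMul E G) (a, φ 1) (0, w)) (φ 1) =
      (((ContinuousLinearMap.apply ℝ E ((0 : E), w)).comp
        (fderiv ℝ (fderiv ℝ (chartMul E G)) (φ 1, φ 1))).comp
        (ContinuousLinearMap.inl ℝ E E)) := fun w =>
    ((((ContinuousLinearMap.apply ℝ E ((0 : E), w)).hasFDerivAt).comp (φ 1, φ 1) hm2).comp
      (f := fun a : E => (a, φ 1)) (φ 1) (hasFDerivAt_prodMk_left (φ 1) (φ 1))).fderiv
  have h1 : ∀ u : E, fderiv ℝ (chartMul E G) (φ 1, φ 1) (0, u) = u := fun u => by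
    rw [fderiv_chartMul_apply (hm.differentiableAt (by simp))]
    have : (fun b => φ ((φ).symm (φ 1) * (φ).symm b)) =ᶠ[𝓝 (φ 1)] id := by
      filter_upwards [extChartAt_target_mem_nhds (I := 𝓘(ℝ, E)) (1 : G)] with b hb
      rw [extChartAt_to_inv, one_mul, (φ).right_inv hb, id]
    rw [this.fderiv_eq, fderiv_id]
    rfl
  obtain ⟨P, hP⟩ : ∃ P : LieAlg E G → E → E, P = fun u a =>
    mpullbackWithin 𝓘(ℝ, E) 𝓘(ℝ, E) (φ).symm (mulInvariantVectorField u) (range 𝓘(ℝ, E)) a :=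
    ⟨_, rfl⟩
  have h0 : ⁅v, w⁆ =
      lieBracketWithin ℝ (P v) (P w) ((φ).symm ⁻¹' univ ∩ range 𝓘(ℝ, E)) (φ 1) := by
    subst hP
    refine (congrArg (fun A : E →L[ℝ] E => A.inverse (lieBracketWithin ℝ
      (fun a => mpullbackWithin 𝓘(ℝ, E) 𝓘(ℝ, E) (φ).symm (mulInvariantVectorField v)
        (range 𝓘(ℝ, E)) a)
      (fun a => mpullbackWithin 𝓘(ℝ, E) 𝓘(ℝ, E) (φ).symm (mulInvariantVectorField w)
        (range 𝓘(ℝ, E)) a) ((φ).symm ⁻¹' univ ∩ range 𝓘(ℝ, E)) (φ 1)))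
      (mfderiv_extChartAt_self (I := 𝓘(ℝ, E)) (x := (1 : G)))).trans ?_
    exact congrArg (fun A : E →L[ℝ] E => A _) ContinuousLinearMap.inverse_id
  have hPu : ∀ u, P u =ᶠ[𝓝 (φ 1)] fun a => fderiv ℝ (chartMul E G) (a, φ 1) (0, u) := by
    subst hP
    exact mpullback_invariantVectorField_chart
  rw [preimage_univ, univ_inter, modelWithCornersSelf_coe, range_id, lieBracketWithin_univ] at h0
  have h2 := (hPu v).lieBracket_vectorField_eq (𝕜 := ℝ) (hPu w)
  have h3 : ∀ v w : E, lieBracket ℝ (fun a => fderiv ℝ (chartMul E G) (a, φ 1) (0, v))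
      (fun a => fderiv ℝ (chartMul E G) (a, φ 1) (0, w)) (φ 1) =
      fderiv ℝ (fderiv ℝ (chartMul E G)) (φ 1, φ 1) (v, 0) (0, w)
      - fderiv ℝ (fderiv ℝ (chartMul E G)) (φ 1, φ 1) (w, 0) (0, v) := by
    intro v w
    rw [lieBracket, hd, hd, h1, h1]
    simp
  exact h0.trans (h2.trans (h3 v w))

end Chart
end HomogeneousSpace

namespace HomogeneousSpace

open Filter Topology Set VectorField

/-! ### Differentiating the adjoint representation; consequences of Ad-invariance -/

section Adjoint

variable {E : Type*} [NormedAddCommGroup E] [NormedSpace ℝ E]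
  {G : Type*} [TopologicalSpace G] [ChartedSpace E G] [Group G] [LieGroup 𝓘(ℝ, E) ∞ G]

local notation "φ" => extChartAt 𝓘(ℝ, E) (1 : G)

theorem contMDiff_conj (x : G) :
    ContMDiff 𝓘(ℝ, E) 𝓘(ℝ, E) ∞ (fun y : G => x * y * x⁻¹) :=
  contMDiff_mul_right.comp contMDiff_mul_left

theorem fderiv_chartConj_apply {a : E} (ha : DifferentiableAt ℝ (chartConj E G) (a, φ 1))
    (X : LieAlg E G) :
    Ad ((φ).symm a) X = fderiv ℝ (chartConj E G) (a, φ 1) (0, X) := by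
  have h := (ha.hasFDerivAt.comp (f := fun b => (a, b)) (φ 1)
    (hasFDerivAt_prodMk_right a (φ 1))).fderiv
  have h2 := mfderiv_chart_comp (E := E) (f := fun y : G => (φ).symm a * y * ((φ).symm a)⁻¹)
    ((contMDiff_conj _).mdifferentiable (by simp) 1) (y := 1) (by simp)
    (mem_extChartAt_source (1 : G)) X
  have h3 := (congrArg (fun A : E →L[ℝ] E => A (Ad (E := E) ((φ).symm a) X))
    (mfderiv_extChartAt_self (I := 𝓘(ℝ, E)) (x := (1 : G)))).symm.trans h2
  exact h3.trans (congrArg (fun A : E →L[ℝ] E => A X) h)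

/-- The differential of `x ↦ Ad x X` at the identity is `v ↦ [v, X]`. -/
theorem hasFDerivAt_Ad (X : LieAlg E G) :
    ∃ A : E →L[ℝ] E, HasFDerivAt (fun a : E => (Ad ((φ).symm a) X : E)) A (φ 1) ∧
      ∀ v : LieAlg E G, A v = ⁅v, X⁆ := by
  have hm : ContDiffAt ℝ 2 (chartMul E G) (φ 1, φ 1) :=
    contDiffAt_chartMul.of_le (by norm_cast)
  have hc : ContDiffAt ℝ 2 (chartConj E G) (φ 1, φ 1) :=
    contDiffAt_chartConj.of_le (by norm_cast)
  have htl : Tendsto (fun a : E => (a, φ 1)) (𝓝 (φ 1)) (𝓝 (φ 1, φ 1)) :=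
    (hasFDerivAt_prodMk_left (𝕜 := ℝ) (φ 1) (φ 1)).continuousAt
  have hd : ∀ᶠ q in 𝓝 (φ 1, φ 1), DifferentiableAt ℝ (chartConj E G) q :=
    (hc.eventually (by simp)).mono fun q hq => hq.differentiableAt (by simp)
  have htgt := extChartAt_target_mem_nhds (I := 𝓘(ℝ, E)) (1 : G)
  have key := hasFDerivAt_partial_conj hm hc
    (by filter_upwards [htgt] with a ha
        simp only [chartMul, extChartAt_to_inv, mul_one, (φ).right_inv ha])
    (by filter_upwards with a
        simp only [chartConj, extChartAt_to_inv, mul_one, mul_inv_cancel])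
    (by filter_upwards [htgt] with b hb
        simp only [chartConj, extChartAt_to_inv, mul_one, one_mul, inv_one, (φ).right_inv hb])
    (by filter_upwards [eventually_extChartAt_symm_conj_mem (E := E) (G := G)] with q hq
        simp only [chartConj, chartMul, (φ).left_inv hq, inv_mul_cancel_right]) X
  refine ⟨_, (key 0).1.congr_of_eventuallyEq ?_, fun v => ?_⟩
  · filter_upwards [htl.eventually hd] with a ha
    exact fderiv_chartConj_apply ha X
  · exact (key v).2.trans (bracket_eq_chart v X).symm

omit [LieGroup 𝓘(ℝ, E) ∞ G] in
theorem IsBiInvariant.Ad_injective {Q : InnerForm (LieAlg E G)} (hQ : IsBiInvariant Q) (x : G) :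
    Function.Injective (Ad x : LieAlg E G →ₗ[ℝ] LieAlg E G) := by
  rw [injective_iff_map_eq_zero]
  intro X hX
  by_contra h
  have := Q.pos X h
  rw [← hQ x, hX] at this
  simp at this

omit [LieGroup 𝓘(ℝ, E) ∞ G] in
theorem Ad_one (X : LieAlg E G) : Ad (1 : G) X = X := by
  have h : (fun y : G => 1 * y * 1⁻¹) = id := by
    ext y
    simp
  have h2 : mfderiv 𝓘(ℝ, E) 𝓘(ℝ, E) (fun y : G => 1 * y * 1⁻¹) 1 =
      ContinuousLinearMap.id ℝ E := by
    rw [h]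
    exact mfderiv_id
  exact congrArg (fun A : E →L[ℝ] E => A X) h2

variable [FiniteDimensional ℝ E]

/-- The function a ↦ Q(Ad a Y, Ad a Z) is constant; its derivative at the identity in direction X is
the required sum. -/
theorem IsBiInvariant.adInvariant {Q : InnerForm (LieAlg E G)} (hQ : IsBiInvariant Q) :
    Q.AdInvariant := by
  intro X Y Z
  obtain ⟨A, hA, hAv⟩ := hasFDerivAt_Ad Y
  obtain ⟨B, hB, hBv⟩ := hasFDerivAt_Ad Z
  let q : E →L[ℝ] E →L[ℝ] ℝ :=
    LinearMap.toContinuousBilinearMap (Q.form : E →ₗ[ℝ] E →ₗ[ℝ] ℝ)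
  have h := q.hasFDerivAt_of_bilinear hA hB
  have h1 : (fun a : E => q (Ad ((φ).symm a) Y : E) (Ad ((φ).symm a) Z : E)) =
      fun _ => Q.form Y Z := funext fun a => hQ ((φ).symm a) Y Z
  have h2 := h.unique (h1 ▸ hasFDerivAt_const (Q.form Y Z) (φ 1))
  have h3 := congrArg (fun A : E →L[ℝ] ℝ => A X) h2
  have h4 : q (Ad ((φ).symm (φ 1)) Y : E) (B X) + q (A X) (Ad ((φ).symm (φ 1)) Z : E) = 0 := h3
  rw [hAv, hBv, extChartAt_to_inv, Ad_one, Ad_one] at h4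
  rw [add_comm]
  exact h4

variable {F : Type*} [NormedAddCommGroup F] [NormedSpace ℝ F]
  {H : Subgroup G} [ChartedSpace F H]

/-- A linear functional l vanishing on V vanishes on Ad x X for all x in H. Differentiating at x = 1
along Z gives l [Z, X] = 0, and such functionals separate V from any vector outside it. -/
theorem lie_mem_of_Ad_invariant (hH : ContMDiff 𝓘(ℝ, F) 𝓘(ℝ, E) ∞ (Subtype.val : H → G))
    {V : Submodule ℝ (LieAlg E G)} (hV : ∀ x ∈ H, ∀ X ∈ V, Ad x X ∈ V)
    {Z X : LieAlg E G} (hZ : Z ∈ lieOfSubgroup E F H) (hX : X ∈ V) : ⁅Z, X⁆ ∈ V := by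
  by_contra hn
  obtain ⟨l, hl, hlV⟩ := Submodule.exists_le_ker_of_notMem hn
  obtain ⟨s, rfl⟩ := hZ
  obtain ⟨A, hA, hAv⟩ := hasFDerivAt_Ad X
  have hd : MDifferentiableAt 𝓘(ℝ, F) 𝓘(ℝ, E) (Subtype.val : H → G) 1 :=
    hH.mdifferentiable (by simp) 1
  set ψ := extChartAt 𝓘(ℝ, F) (1 : H) with hψ
  let u : F → E := fun b => φ (ψ.symm b : G)
  have hu : DifferentiableAt ℝ u (ψ 1) := by
    have := hd.differentiableWithinAt_writtenInExtChartAt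
    rw [modelWithCornersSelf_coe, range_id, differentiableWithinAt_univ] at this
    exact this
  have hu2 : (mfderiv 𝓘(ℝ, F) 𝓘(ℝ, E) (Subtype.val : H → G) 1 s : E) = fderiv ℝ u (ψ 1) s := by
    have h := congrArg (fun A : F →L[ℝ] E => A s) hd.mfderiv
    rw [modelWithCornersSelf_coe, range_id, fderivWithin_univ] at h
    exact h
  have hu1 : u (ψ 1) = φ 1 := by simp [u, ψ]
  rw [← hu1] at hA
  let l' : E →L[ℝ] ℝ := LinearMap.toContinuousLinearMap (l : E →ₗ[ℝ] ℝ)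
  obtain ⟨R, hR⟩ : ∃ R : E → E, R = fun a => Ad ((φ).symm a) X := ⟨_, rfl⟩
  have hA' : HasFDerivAt R A (u (ψ 1)) := hR ▸ hA
  have h1 : HasFDerivAt (fun b => l' (R (u b)))
      (l'.comp (A.comp (fderiv ℝ u (ψ 1)))) (ψ 1) :=
    l'.hasFDerivAt.comp (ψ 1) (hA'.comp (ψ 1) hu.hasFDerivAt)
  have h2 : (fun b => l' (R (u b))) =ᶠ[𝓝 (ψ 1)] fun _ => 0 := by
    have hc : ContinuousAt (fun b => (ψ.symm b : G)) (ψ 1) := by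
      refine hd.continuousAt.comp_of_eq (continuousAt_extChartAt_symm (1 : H)) ?_
      simp [ψ]
    have hs : (φ).source ∈ 𝓝 ((ψ.symm (ψ 1) : H) : G) := by
      have := extChartAt_source_mem_nhds (I := 𝓘(ℝ, E)) (1 : G)
      simpa [ψ] using this
    filter_upwards [hc.eventually_mem hs] with b hb
    have : (φ).symm (u b) = (ψ.symm b : G) := (φ).left_inv hb
    simp only [hR, this]
    exact hlV (hV _ (ψ.symm b).2 X hX)
  have h3 := h1.unique ((hasFDerivAt_const (0 : ℝ) (ψ 1)).congr_of_eventuallyEq h2)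
  have h4 : l' (A (fderiv ℝ u (ψ 1) s)) = 0 := congrArg (fun A : F →L[ℝ] ℝ => A s) h3
  refine hl ?_
  rw [← hu2, hAv] at h4
  exact h4

-- The inclusion H → G intertwines conjugation by x in H and in G; this is the chain rule at 1 for
-- both compositions.
omit [FiniteDimensional ℝ E] in
theorem Ad_mem_lieOfSubgroup [LieGroup 𝓘(ℝ, F) ∞ H]
    (hH : ContMDiff 𝓘(ℝ, F) 𝓘(ℝ, E) ∞ (Subtype.val : H → G)) {x : G} (hx : x ∈ H)
    {Z : LieAlg E G} (hZ : Z ∈ lieOfSubgroup E F H) : Ad x Z ∈ lieOfSubgroup E F H := by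
  obtain ⟨s, rfl⟩ := hZ
  have hd : MDifferentiable 𝓘(ℝ, F) 𝓘(ℝ, E) (Subtype.val : H → G) := hH.mdifferentiable (by simp)
  let c : H → H := fun y => ⟨x, hx⟩ * y * ⟨x, hx⟩⁻¹
  have hc : MDifferentiableAt 𝓘(ℝ, F) 𝓘(ℝ, F) c 1 :=
    (contMDiff_conj (⟨x, hx⟩ : H)).mdifferentiable (by simp) 1
  have h1 := mfderiv_comp (1 : H) (hd (c 1)) hc
  have h2 : Subtype.val ∘ c = (fun y : G => x * y * x⁻¹) ∘ Subtype.val := by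
    ext y
    simp [c]
  have h3 := mfderiv_comp (1 : H)
    ((contMDiff_conj (E := E) x).mdifferentiable (by simp) ((1 : H) : G)) (hd 1)
  have hc1 : c 1 = 1 := by simp [c]
  -- The chain rule yields the derivative at c 1, which equals 1 only propositionally, hence the
  -- variable base point.
  have h4 : ∀ (y : H) (_ : y = 1) (t : F),
      (mfderiv 𝓘(ℝ, F) 𝓘(ℝ, E) (Subtype.val : H → G) y t : E) ∈ lieOfSubgroup E F H := by
    rintro y rfl t
    exact ⟨t, rfl⟩
  rw [h2] at h1
  have h5 := congrArg (fun A : F →L[ℝ] E => A s) (h3.symm.trans h1)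
  have h6 := h4 (c 1) hc1 (mfderiv 𝓘(ℝ, F) 𝓘(ℝ, F) c 1 s)
  exact (congrArg (fun v : LieAlg E G => v ∈ lieOfSubgroup E F H) h5).mpr h6

/-- Ad x is injective and 𝔥 is finite-dimensional, so Ad x maps 𝔥 onto itself; being a Q-isometry,
it preserves the complement. -/
theorem Ad_mem_isotropySpace [LieGroup 𝓘(ℝ, F) ∞ H] {Q : InnerForm (LieAlg E G)}
    (hQ : IsBiInvariant Q) (hH : ContMDiff 𝓘(ℝ, F) 𝓘(ℝ, E) ∞ (Subtype.val : H → G)) {x : G}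
    (hx : x ∈ H) {X : LieAlg E G} (hX : X ∈ isotropySpace F Q H) :
    Ad x X ∈ isotropySpace F Q H := by
  intro Z hZ
  have hmap : (lieOfSubgroup E F H).map (Ad x) = lieOfSubgroup E F H := by
    refine Submodule.eq_of_le_of_finrank_eq ?_
      ((Submodule.equivMapOfInjective _ (hQ.Ad_injective x) _).finrank_eq.symm)
    rintro _ ⟨Y, hY, rfl⟩
    exact Ad_mem_lieOfSubgroup hH hx hY
  rw [← hmap] at hZ
  obtain ⟨Y, hY, rfl⟩ := hZ
  exact (hQ x Y X).trans (hX Y hY)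

end Adjoint
end HomogeneousSpace

namespace HomogeneousSpace

open Filter Topology Set InnerForm

/-! ### Convergence in spaces without a chosen norm; limits of orthonormal frames -/

section WeakTendsto

variable {α V W : Type*} [AddCommGroup V] [Module ℝ V] [AddCommGroup W] [Module ℝ W]
  {l : Filter α}

/-- Convergence of all linear functionals. -/
def WeakTendsto (X : α → V) (l : Filter α) (X₀ : V) : Prop :=
  ∀ ξ : Module.Dual ℝ V, Tendsto (fun a => ξ (X a)) l (𝓝 (ξ X₀))

theorem WeakTendsto.map {X : α → V} {X₀ : V} (h : WeakTendsto X l X₀) (A : V →ₗ[ℝ] W) :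
    WeakTendsto (fun a => A (X a)) l (A X₀) :=
  fun ξ => h (ξ ∘ₗ A)

variable [Module.Finite ℝ V]

theorem WeakTendsto.bilin {X : α → V} {X₀ : V} {Y : α → W} {Y₀ : W} (hX : WeakTendsto X l X₀)
    (hY : WeakTendsto Y l Y₀) (B : V →ₗ[ℝ] W →ₗ[ℝ] ℝ) :
    Tendsto (fun a => B (X a) (Y a)) l (𝓝 (B X₀ Y₀)) := by
  let b := Module.finBasis ℝ V
  have h : ∀ X Y, B X Y = ∑ i, b.coord i X * B (b i) Y := fun X Y => by
    conv_lhs => rw [← b.sum_repr X]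
    simp only [map_sum, map_smul, LinearMap.sum_apply, LinearMap.smul_apply, smul_eq_mul,
      Module.Basis.coord_apply]
  rw [h X₀ Y₀, funext fun a => h (X a) (Y a)]
  exact tendsto_finsetSum _ fun i _ => (hX _).mul (hY (B (b i)))

theorem WeakTendsto.lie {L : Type*} [LieRing L] [LieAlgebra ℝ L] [Module.Finite ℝ L]
    {X Y : α → L} {X₀ Y₀ : L} (hX : WeakTendsto X l X₀) (hY : WeakTendsto Y l Y₀) :
    WeakTendsto (fun a => ⁅X a, Y a⁆) l ⁅X₀, Y₀⁆ :=
  fun ξ => hX.bilin hY ((LieAlgebra.ad ℝ L : L →ₗ[ℝ] Module.End ℝ L).compr₂ ξ)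

variable {ι : Type*} [DecidableEq ι]

/-- Orthonormal families converge along ultrafilters. -/
theorem InnerForm.exists_orthonormal_limit (Q : InnerForm V) (U : Ultrafilter α)
    (f : α → ι → V) (hf : ∀ a, Q.Orthonormal (f a)) :
    ∃ f₀ : ι → V, Q.Orthonormal f₀ ∧ ∀ i, WeakTendsto (fun a => f a i) U (f₀ i) := by
  -- Diagonalizing Q against itself merely supplies a reference orthonormal basis; Parseval then
  -- puts all coordinates in [-1, 1].
  obtain ⟨b, -, hb, -⟩ := Q.exists_orthonormal_diagonal Q
  have hmem : ∀ i k a, Q.form (f a i) (b k) ∈ Icc (-1 : ℝ) 1 := fun i k a => by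
    rw [mem_Icc, ← abs_le, ← sq_le_one_iff_abs_le_one]
    have h := hb.form_eq_sum (f a i) (f a i)
    rw [hf a i i, if_pos rfl] at h
    rw [h, sq]
    exact Finset.single_le_sum (f := fun k => Q.form (f a i) (b k) * Q.form (f a i) (b k))
      (fun k _ => mul_self_nonneg _) (Finset.mem_univ k)
  have hlim : ∀ i k, ∃ u : ℝ, Tendsto (fun a => Q.form (f a i) (b k)) U (𝓝 u) := fun i k => by
    obtain ⟨u, -, hu⟩ := isCompact_iff_ultrafilter_le_nhds.mp
      (isCompact_Icc (a := (-1 : ℝ)) (b := 1)) (U.map fun a => Q.form (f a i) (b k))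
      (le_principal_iff.mpr (Filter.mem_map.mpr (Filter.univ_mem' (hmem i k))))
    exact ⟨u, hu⟩
  choose u hu using hlim
  have hw : ∀ i, WeakTendsto (fun a => f a i) U (∑ k, u i k • b k) := fun i ξ => by
    have h : ∀ a, ξ (f a i) = ∑ k, Q.form (f a i) (b k) * ξ (b k) := fun a => by
      conv_lhs => rw [← hb.sum_smul (f a i)]
      simp
    simp_rw [h, map_sum, map_smul, smul_eq_mul]
    exact tendsto_finsetSum _ fun k _ => (hu i k).mul_const _
  refine ⟨fun i => ∑ k, u i k • b k, fun i j => ?_, hw⟩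
  refine tendsto_nhds_unique ((hw i).bilin (hw j) Q.form) ?_
  simp_rw [fun a => hf a i j]
  exact tendsto_const_nhds

end WeakTendsto

/-! ### Scalar curvature along degenerating metrics -/

section Semicontinuity

variable {α L ι : Type*} [LieRing L] [LieAlgebra ℝ L] [Module.Finite ℝ L] [Fintype ι]
  {Q : InnerForm L} {l : Filter α} {f : α → ι → L} {w : α → ι → ℝ} {f₀ : ι → L} {y : ι → ℝ}
  {s : ℝ}

omit [Fintype ι] in
theorem tendsto_structureConst (hf : ∀ i, WeakTendsto (fun a => f a i) l (f₀ i)) (i j k : ι) :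
    Tendsto (fun a => structureConst Q (f a) i j k) l (𝓝 (structureConst Q f₀ i j k)) :=
  ((hf i).lie (hf j)).bilin (hf k) Q.form

omit [Fintype ι] in
theorem tendsto_normSq_lie (hf : ∀ i, WeakTendsto (fun a => f a i) l (f₀ i)) (i j : ι) :
    Tendsto (fun a => Q.form ⁅f a i, f a j⁆ ⁅f a i, f a j⁆) l
      (𝓝 (Q.form ⁅f₀ i, f₀ j⁆ ⁅f₀ i, f₀ j⁆)) :=
  ((hf i).lie (hf j)).bilin ((hf i).lie (hf j)) Q.form

/-- If the scalar curvatures are bounded below, then the directions in which the metrics stay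
bounded are closed under the bracket, up to isotropy. -/
theorem structureConst_eq_zero_of_le_frameScalar [l.NeBot]
    (hf : ∀ i, WeakTendsto (fun a => f a i) l (f₀ i))
    (hw : ∀ i, Tendsto (fun a => w a i) l (𝓝 (y i))) (hpos : ∀ a i, 0 < w a i)
    (hs : ∀ᶠ a in l, s ≤ frameScalar Q (f a) (w a)) {i j k : ι} (hi : 0 < y i) (hj : 0 < y j)
    (hk : y k = 0) : structureConst Q f₀ i j k = 0 := by
  -- All subtracted terms of `frameScalar` are nonnegative, so one of them is at most the positive
  -- part minus s. Multiplied by w k, the right side tends to 0 because the positive part converges.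
  have hle : ∀ᶠ a in l, structureConst Q (f a) i j k ^ 2 * (w a i * w a j) ≤
      4 * (∑ i, ∑ j, Q.form ⁅f a i, f a j⁆ ⁅f a i, f a j⁆ * w a i - s) * w a k := by
    filter_upwards [hs] with a ha
    have hnn : ∀ i j k, 0 ≤ structureConst Q (f a) i j k ^ 2 *
        (w a i / 2 + w a i * w a j / w a k / 4) := fun i j k => by
      have := hpos a i
      have := hpos a j
      have := hpos a k
      positivity
    have h1 : structureConst Q (f a) i j k ^ 2 * (w a i / 2 + w a i * w a j / w a k / 4) ≤
        ∑ i, ∑ j, ∑ k, structureConst Q (f a) i j k ^ 2 *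
          (w a i / 2 + w a i * w a j / w a k / 4) := by
      refine (Finset.single_le_sum (f := fun k => structureConst Q (f a) i j k ^ 2 *
        (w a i / 2 + w a i * w a j / w a k / 4)) (fun k _ => hnn i j k)
        (Finset.mem_univ k)).trans ?_
      refine (Finset.single_le_sum (f := fun j => ∑ k, structureConst Q (f a) i j k ^ 2 *
        (w a i / 2 + w a i * w a j / w a k / 4))
        (fun j _ => Finset.sum_nonneg fun k _ => hnn i j k) (Finset.mem_univ j)).trans ?_
      exact Finset.single_le_sum (f := fun i => ∑ j, ∑ k, structureConst Q (f a) i j k ^ 2 *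
        (w a i / 2 + w a i * w a j / w a k / 4))
        (fun i _ => Finset.sum_nonneg fun j _ => Finset.sum_nonneg fun k _ => hnn i j k)
        (Finset.mem_univ i)
    rw [frameScalar] at ha
    have hk := hpos a k
    have h2 : structureConst Q (f a) i j k ^ 2 * (w a i * w a j / w a k / 4) ≤
        ∑ i, ∑ j, Q.form ⁅f a i, f a j⁆ ⁅f a i, f a j⁆ * w a i - s := by
      have : 0 ≤ structureConst Q (f a) i j k ^ 2 * (w a i / 2) := by
        have := hpos a i
        positivity
      linarith
    have h3 := mul_le_mul_of_nonneg_right h2 hk.le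
    have h4 : structureConst Q (f a) i j k ^ 2 * (w a i * w a j / w a k / 4) * w a k =
        structureConst Q (f a) i j k ^ 2 * (w a i * w a j) / 4 := by
      field_simp
    linarith
  have hlim := le_of_tendsto_of_tendsto
    (((tendsto_structureConst (Q := Q) hf i j k).pow 2).mul ((hw i).mul (hw j)))
    (((((tendsto_finsetSum _ fun i _ => tendsto_finsetSum _ fun j _ =>
      (tendsto_normSq_lie (Q := Q) hf i j).mul (hw i)).sub_const s).const_mul 4).mul (hw k))) hle
  rw [hk, mul_zero] at hlim
  have hij := mul_pos hi hj
  have h0 : structureConst Q f₀ i j k ^ 2 ≤ 0 := by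
    by_contra h
    exact absurd (mul_pos (not_le.mp h) hij) (not_lt.mpr hlim)
  exact pow_eq_zero_iff two_ne_zero |>.mp (le_antisymm h0 (sq_nonneg _))

/-- The part of the term `w i * w j / w k / 4` which survives in the limit `w → y`. -/
noncomputable def survivingTerm (y w : ι → ℝ) (i j k : ι) : ℝ :=
  if 0 < y i then
    if 0 < y j then if 0 < y k then w i * w j / w k / 4 else 0
    else if 0 < y k then 0 else w i / 2
  else 0

omit [Fintype ι] in
theorem two_mul_le_div_add_div {a b c : ℝ} (ha : 0 < a) (hb : 0 < b) (hc : 0 < c) :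
    a / 2 ≤ a * b / c / 4 + c * a / b / 4 := by
  have h : a * b / c / 4 + c * a / b / 4 - a / 2 = a * (b - c) ^ 2 / (b * c) / 4 := by
    field_simp
    ring
  have : 0 ≤ a * (b - c) ^ 2 / (b * c) / 4 := by positivity
  linarith

-- The estimate fails termwise and needs the cyclic sum. With three surviving indices it is an
-- equality, with exactly one it is `two_mul_le_div_add_div`, and otherwise the left side is 0.
omit [Fintype ι] in
theorem survivingTerm_cyclic_le (y : ι → ℝ) {w : ι → ℝ} (hw : ∀ i, 0 < w i) (i j k : ι) :
    survivingTerm y w i j k + survivingTerm y w j k i + survivingTerm y w k i j ≤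
      w i * w j / w k / 4 + w j * w k / w i / 4 + w k * w i / w j / 4 := by
  have hi := hw i
  have hj := hw j
  have hk := hw k
  have h1 : 0 < w i * w j / w k / 4 := by positivity
  have h2 : 0 < w j * w k / w i / 4 := by positivity
  have h3 : 0 < w k * w i / w j / 4 := by positivity
  have h4 := two_mul_le_div_add_div hi hj hk
  have h5 := two_mul_le_div_add_div hj hk hi
  have h6 := two_mul_le_div_add_div hk hi hj
  unfold survivingTerm
  split_ifs <;> linarith

omit [Module.Finite ℝ L] in
theorem sum_survivingTerm_le (hQ : Q.AdInvariant) (f : ι → L) (y : ι → ℝ) {w : ι → ℝ}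
    (hw : ∀ i, 0 < w i) :
    ∑ i, ∑ j, ∑ k, structureConst Q f i j k ^ 2 * survivingTerm y w i j k ≤
      ∑ i, ∑ j, ∑ k, structureConst Q f i j k ^ 2 * (w i * w j / w k / 4) := by
  have h1 := hQ.sum_structureConst_sq_rotate f (survivingTerm y w)
  have h2 := hQ.sum_structureConst_sq_rotate f (fun i j k => survivingTerm y w j k i)
  have h3 := hQ.sum_structureConst_sq_rotate f (fun i j k => w i * w j / w k / 4)
  have h4 := hQ.sum_structureConst_sq_rotate f (fun i j k => w j * w k / w i / 4)
  have h5 : ∑ i, ∑ j, ∑ k, structureConst Q f i j k ^ 2 *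
      (survivingTerm y w i j k + survivingTerm y w j k i + survivingTerm y w k i j) ≤
      ∑ i, ∑ j, ∑ k, structureConst Q f i j k ^ 2 *
        (w i * w j / w k / 4 + w j * w k / w i / 4 + w k * w i / w j / 4) :=
    Finset.sum_le_sum fun i _ => Finset.sum_le_sum fun j _ => Finset.sum_le_sum fun k _ =>
      mul_le_mul_of_nonneg_left (survivingTerm_cyclic_le y hw i j k) (sq_nonneg _)
  simp only [mul_add, Finset.sum_add_distrib] at h5
  linarith

theorem sum_eq_sum_subtype_pos {ι M : Type*} [Fintype ι] [AddCommMonoid M] {y : ι → ℝ} {h : ι → M}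
    (hh : ∀ i, ¬ 0 < y i → h i = 0) : ∑ i, h i = ∑ i : {i // 0 < y i}, h i := by
  rw [← Fintype.sum_subtype_add_sum_subtype (fun i => 0 < y i) h,
    Finset.sum_eq_zero (s := (Finset.univ : Finset {i // ¬ 0 < y i})) fun i _ => hh i i.2, add_zero]

/-- Upper semicontinuity of the scalar curvature under degeneration: if the metrics blow up exactly
in the directions `f₀ j` with `y j = 0`, then the scalar curvature of the limit metric on the
remaining directions is at least the limit of the scalar curvatures. -/
theorem le_frameScalar_limit [l.NeBot] (hQ : Q.AdInvariant)
    (hf : ∀ i, WeakTendsto (fun a => f a i) l (f₀ i))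
    (hw : ∀ i, Tendsto (fun a => w a i) l (𝓝 (y i))) (hpos : ∀ a i, 0 < w a i)
    (hs : ∀ᶠ a in l, s ≤ frameScalar Q (f a) (w a))
    (hlie : ∀ i j, 0 < y i → y j = 0 → Q.form ⁅f₀ i, f₀ j⁆ ⁅f₀ i, f₀ j⁆ =
      ∑ k, structureConst Q f₀ i j k ^ 2) :
    s ≤ frameScalar Q (fun i : {i // 0 < y i} => f₀ i) (fun i => y i) := by
  have hy : ∀ i, 0 ≤ y i := fun i => ge_of_tendsto (hw i) (.of_forall fun a => (hpos a i).le)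
  have hy0 : ∀ i, ¬ 0 < y i → y i = 0 := fun i hi => le_antisymm (not_lt.mp hi) (hy i)
  have hzero : ∀ i j k, 0 < y i → 0 < y j → ¬ 0 < y k → structureConst Q f₀ i j k = 0 :=
    fun i j k hi hj hk => structureConst_eq_zero_of_le_frameScalar hf hw hpos hs hi hj (hy0 k hk)
  -- The quotients w i w j / w k need not converge; replacing them by the smaller surviving terms
  -- weakens the bound but lets every term pass to the limit.
  have hle : ∀ᶠ a in l, s ≤ ∑ i, ∑ j, Q.form ⁅f a i, f a j⁆ ⁅f a i, f a j⁆ * w a i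
      - ∑ i, ∑ j, ∑ k, structureConst Q (f a) i j k ^ 2 *
        (w a i / 2 + survivingTerm y (w a) i j k) := by
    filter_upwards [hs] with a ha
    have h := sum_survivingTerm_le hQ (f a) y (hpos a)
    rw [frameScalar] at ha
    simp only [mul_add, Finset.sum_add_distrib] at ha ⊢
    linarith
  have hsurv : ∀ i j k, Tendsto (fun a => survivingTerm y (w a) i j k) l
      (𝓝 (survivingTerm y y i j k)) := fun i j k => by
    unfold survivingTerm
    split_ifs with hi hj hk
    · exact (((hw i).mul (hw j)).div (hw k) hk.ne').div_const 4
    · exact tendsto_const_nhds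
    · exact tendsto_const_nhds
    · exact (hw i).div_const 2
    · exact tendsto_const_nhds
  have hlim := ge_of_tendsto ((tendsto_finsetSum _ fun i _ => tendsto_finsetSum _ fun j _ =>
      (tendsto_normSq_lie (Q := Q) hf i j).mul (hw i)).sub
    (tendsto_finsetSum _ fun i _ => tendsto_finsetSum _ fun j _ => tendsto_finsetSum _ fun k _ =>
      ((tendsto_structureConst (Q := Q) hf i j k).pow 2).mul
        (((hw i).div_const 2).add (hsurv i j k)))) hle
  refine hlim.trans (le_of_eq ?_)
  rw [frameScalar, ← Finset.sum_sub_distrib, ← Finset.sum_sub_distrib, sum_eq_sum_subtype_pos]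
  · refine Finset.sum_congr rfl fun i _ => ?_
    rw [← Finset.sum_sub_distrib, ← Finset.sum_sub_distrib, sum_eq_sum_subtype_pos]
    · refine Finset.sum_congr rfl fun j _ => ?_
      congr 1
      rw [sum_eq_sum_subtype_pos]
      · refine Finset.sum_congr rfl fun k _ => ?_
        simp [survivingTerm, i.2, j.2, k.2, structureConst]
      · intro k hk
        rw [hzero i j k i.2 j.2 hk]
        simp
    -- For i surviving and j blown up, |[f₀ i, f₀ j]|² y i cancels exactly: structure constants with
    -- k surviving vanish, and for k blown up the two halves y i / 2 add up to y i.
    · intro j hj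
      rw [hlie i j i.2 (hy0 j hj), Finset.sum_mul, sub_eq_zero]
      refine Finset.sum_congr rfl fun k _ => ?_
      by_cases hk : 0 < y k
      · have h := hzero i k j i.2 hk hj
        rw [hQ.structureConst_swap_right, neg_eq_zero] at h
        rw [h]
        simp
      · simp [survivingTerm, i.2, hj, hk]
  · intro i hi
    simp [survivingTerm, hy0 i hi]

end Semicontinuity

end HomogeneousSpace

namespace HomogeneousSpace

open Filter Topology Set

namespace InnerForm

/-! ### Inner products built from bases -/

section Frames

variable {V κ : Type*} [AddCommGroup V] [Module ℝ V] [DecidableEq κ] [Fintype κ]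

/-- The inner product which is diagonal in the basis `b`, with squared norms `x`. -/
noncomputable def ofBasis (b : Module.Basis κ ℝ V) (x : κ → ℝ) (hx : ∀ i, 0 < x i) :
    InnerForm V where
  form := LinearMap.mk₂ ℝ (fun X Y => ∑ i, x i * b.repr X i * b.repr Y i)
    (fun X X' Y => by simp [mul_add, add_mul, Finset.sum_add_distrib])
    (fun r X Y => by
      rw [smul_eq_mul, Finset.mul_sum]
      refine Finset.sum_congr rfl fun i _ => ?_
      simp only [map_smul, Finsupp.smul_apply, smul_eq_mul]
      ring)
    (fun X Y Y' => by simp [mul_add, Finset.sum_add_distrib])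
    (fun r X Y => by
      rw [smul_eq_mul, Finset.mul_sum]
      refine Finset.sum_congr rfl fun i _ => ?_
      simp only [map_smul, Finsupp.smul_apply, smul_eq_mul]
      ring)
  symm X Y := Finset.sum_congr rfl fun i _ => by ring
  pos X hX := by
    have h : ∃ i, b.repr X i ≠ 0 := by
      by_contra! h
      exact hX (b.repr.map_eq_zero_iff.mp (Finsupp.ext h))
    obtain ⟨i, hi⟩ := h
    refine Finset.sum_pos' (fun j _ => ?_) ⟨i, Finset.mem_univ i, ?_⟩
    · rw [mul_assoc]
      exact mul_nonneg (hx j).le (mul_self_nonneg _)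
    · rw [mul_assoc]
      exact mul_pos (hx i) (mul_self_pos.mpr hi)

theorem ofBasis_diagonal (b : Module.Basis κ ℝ V) (x : κ → ℝ) (hx : ∀ i, 0 < x i) :
    (ofBasis b x hx).Diagonal b x := fun i j => by
  have h : (ofBasis b x hx).form (b i) (b j) =
      ∑ k, x k * b.repr (b i) k * b.repr (b j) k := rfl
  rw [h, Finset.sum_eq_single i]
  · simp [Finsupp.single_apply, eq_comm]
  · intro k _ hk
    simp [Finsupp.single_apply, hk.symm]
  · simp

omit [Fintype κ] in
theorem Orthonormal.linearIndependent {Q : InnerForm V} {f : κ → V} (hf : Q.Orthonormal f) :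
    LinearIndependent ℝ f := by
  rw [linearIndependent_iff']
  intro s c hc i hi
  have h : Q.form (∑ j ∈ s, c j • f j) (f i) = c i := by
    simp [hf _ i, hi]
  rw [← h, hc]
  simp

end Frames

/-! ### Isometries, eigenspaces and the surviving subspace -/

section Isometry

variable {L ι : Type*} [AddCommGroup L] [Module ℝ L] [Fintype ι] [DecidableEq ι]
  {Q : InnerForm L} {m : Submodule ℝ L} {A : L →ₗ[ℝ] L} {f : Module.Basis ι ℝ m}

theorem exists_isometry_eq [Module.Finite ℝ L] (hA : ∀ X Y, Q.form (A X) (A Y) = Q.form X Y)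
    (hAm : ∀ X ∈ m, A X ∈ m) (Y : m) : ∃ X : m, A (X : L) = Y := by
  have hinj : Function.Injective (A.restrict hAm) := by
    rw [injective_iff_map_eq_zero]
    intro X hX
    by_contra h
    have h1 := Q.pos X fun h0 => h (Subtype.ext h0)
    rw [← hA, show A (X : L) = 0 from congrArg Subtype.val hX] at h1
    simp at h1
  obtain ⟨X, hX⟩ := LinearMap.injective_iff_surjective.mp hinj Y
  exact ⟨X, congrArg Subtype.val hX⟩

/-- Isometries of both `Q` and `g` preserve the eigenspaces of `g` with respect to `Q`. -/
theorem Diagonal.mul_form_isometry [Module.Finite ℝ L]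
    (hA : ∀ X Y, Q.form (A X) (A Y) = Q.form X Y)
    (hAm : ∀ X ∈ m, A X ∈ m) {g : InnerForm m}
    (hg : ∀ X Y X' Y' : m, (X' : L) = A X → (Y' : L) = A Y → g.form X' Y' = g.form X Y)
    (hf : (Q.restrict m).Orthonormal f) {x : ι → ℝ} (hx : g.Diagonal f x) (i j : ι) :
    x i * Q.form (A (f i)) (f j) = x j * Q.form (A (f i)) (f j) := by
  obtain ⟨Y, hY⟩ := exists_isometry_eq hA hAm (f j)
  let X' : m := ⟨A (f i), hAm _ (f i).2⟩
  have h1 : g.form X' (f j) = x j * Q.form (A (f i)) (f j) := by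
    rw [hx.form_basis, ← hf.form_basis]
    rfl
  have h2 : g.form (f i) Y = x i * Q.form (A (f i)) (f j) := by
    rw [g.symm, hx.form_basis, ← hf.form_basis, ← hY, hA, Q.symm]
    rfl
  rw [← h1, ← h2]
  exact (hg (f i) Y X' (f j) rfl hY.symm).symm

/-- Isometries of `Q` which preserve the eigenspaces of `g` with respect to `Q` are isometries
of `g`. -/
theorem Diagonal.isometry (hA : ∀ X Y, Q.form (A X) (A Y) = Q.form X Y) {g : InnerForm m}
    (hf : (Q.restrict m).Orthonormal f) {x : ι → ℝ} (hx : g.Diagonal f x)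
    (hq : ∀ i j, x i * Q.form (A (f i)) (f j) = x j * Q.form (A (f i)) (f j))
    (X Y X' Y' : m) (hX : (X' : L) = A X) (hY : (Y' : L) = A Y) :
    g.form X' Y' = g.form X Y := by
  have hrepr : ∀ (Z : m) i, f.repr Z i = Q.form (Z : L) (f i) := fun Z i =>
    (hf.form_basis Z i).symm
  have hXs : (X : L) = ∑ i, f.repr X i • (f i : L) := by
    conv_lhs => rw [← f.sum_repr X]
    simp [-Module.Basis.sum_repr]
  have hYs : (Y' : L) = ∑ j, f.repr Y' j • (f j : L) := by
    conv_lhs => rw [← f.sum_repr Y']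
    simp [-Module.Basis.sum_repr]
  have h1 : ∀ j, f.repr X' j = ∑ i, f.repr X i * Q.form (A (f i)) (f j) := fun j => by
    rw [hrepr, hX, hXs]
    simp only [map_sum, map_smul, LinearMap.sum_apply, LinearMap.smul_apply, smul_eq_mul]
  have h2 : ∀ i, f.repr Y i = ∑ j, f.repr Y' j * Q.form (A (f i)) (f j) := fun i => by
    rw [hrepr, ← hA, ← hY, Q.symm, hYs]
    simp only [map_sum, map_smul, smul_eq_mul]
  rw [hx.form_eq_sum, hx.form_eq_sum]
  calc ∑ j, x j * f.repr X' j * f.repr Y' j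
      = ∑ j, ∑ i, x i * f.repr X i * (f.repr Y' j * Q.form (A (f i)) (f j)) := by
        refine Finset.sum_congr rfl fun j _ => ?_
        rw [h1, Finset.mul_sum, Finset.sum_mul]
        refine Finset.sum_congr rfl fun i _ => ?_
        linear_combination -f.repr X i * f.repr Y' j * hq i j
    _ = ∑ i, x i * f.repr X i * f.repr Y i := by
        rw [Finset.sum_comm]
        refine Finset.sum_congr rfl fun i _ => ?_
        rw [h2, Finset.mul_sum]

variable {y : ι → ℝ}

/-- The subspace of vectors orthogonal to the frame vectors `f j` with `y j = 0`. -/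
def kernelOrthogonal (Q : InnerForm L) (f : ι → L) (y : ι → ℝ) : Submodule ℝ L where
  carrier := {X | ∀ j, y j = 0 → Q.form X (f j) = 0}
  add_mem' hX hY j hj := by simp [hX j hj, hY j hj]
  zero_mem' := by simp
  smul_mem' c X hX j hj := by simp [hX j hj]

/-- Write f j = A Y with Y in m. If y j = 0, then `hq` leaves in Y only components along f i with y
i = 0, and X is orthogonal to these, so Q(A X, f j) = Q(X, Y) = 0. -/
theorem isometry_mem_kernelOrthogonal [Module.Finite ℝ L]
    (hA : ∀ X Y, Q.form (A X) (A Y) = Q.form X Y)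
    (hAm : ∀ X ∈ m, A X ∈ m) (hf : (Q.restrict m).Orthonormal f)
    (hq : ∀ i j, y i * Q.form (A (f i)) (f j) = y j * Q.form (A (f i)) (f j)) {X : L}
    (hX : X ∈ Q.kernelOrthogonal (fun i => (f i : L)) y) :
    A X ∈ Q.kernelOrthogonal (fun i => (f i : L)) y := by
  intro j hj
  obtain ⟨Y, hY⟩ := exists_isometry_eq hA hAm (f j)
  have hYs : (Y : L) = ∑ i, Q.form (A (f i)) (f j) • (f i : L) := by
    conv_lhs => rw [← f.sum_repr Y]
    rw [Submodule.coe_sum]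
    refine Finset.sum_congr rfl fun i _ => ?_
    rw [← hf.form_basis, ← hY, hA, Q.symm]
    rfl
  change Q.form (A X) (f j) = 0
  rw [← hY, hA, hYs, map_sum]
  refine Finset.sum_eq_zero fun i _ => ?_
  rw [map_smul, smul_eq_mul]
  by_cases hi : y i = 0
  · rw [hX i hi, mul_zero]
  · have h := hq i j
    rw [hj, zero_mul] at h
    rw [(mul_eq_zero.mp h).resolve_left hi, zero_mul]

/-- The frame vectors `f i` with `0 < y i` form a basis of the orthogonal complement in `m` of
the frame vectors `f j` with `y j = 0`. -/
theorem exists_basis_kernelOrthogonal (hf : (Q.restrict m).Orthonormal f) (hy : ∀ i, 0 ≤ y i)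
    {p : Submodule ℝ L} (hp : p = Q.kernelOrthogonal (fun i => (f i : L)) y ⊓ m) :
    ∃ c : Module.Basis {i // 0 < y i} ℝ p, (∀ i, (c i : L) = f i) ∧ (Q.restrict p).Orthonormal c := by
  have hfQ : ∀ i j, Q.form (f i : L) (f j) = if i = j then 1 else 0 := hf
  have hmem : ∀ i : {i // 0 < y i}, (f i : L) ∈ p := fun i => by
    rw [hp]
    refine ⟨fun j hj => ?_, (f i).2⟩
    rw [hfQ, if_neg]
    rintro rfl
    exact i.2.ne' hj
  let c : {i // 0 < y i} → p := fun i => ⟨f i, hmem i⟩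
  have hc : (Q.restrict p).Orthonormal c := fun i j => by
    have : (Q.restrict p).form (c i) (c j) = Q.form (f i : L) (f j) := rfl
    rw [this, hfQ]
    simp [Subtype.ext_iff]
  have hspan : ⊤ ≤ Submodule.span ℝ (range c) := fun X _ => by
    have hX : (X : L) ∈ Q.kernelOrthogonal (fun i => (f i : L)) y ⊓ m := hp ▸ X.2
    have h : X = ∑ i : {i // 0 < y i}, Q.form (X : L) (f i) • c i := by
      apply Subtype.ext
      rw [Submodule.coe_sum]
      have h1 := congrArg Subtype.val (hf.sum_smul ⟨X, hX.2⟩)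
      rw [Submodule.coe_sum, sum_eq_sum_subtype_pos (y := y)] at h1
      · exact h1.symm
      · intro i hi
        have : (Q.restrict m).form ⟨X, hX.2⟩ (f i) = 0 :=
          hX.1 i (le_antisymm (not_lt.mp hi) (hy i))
        rw [this, zero_smul]
        rfl
    rw [h]
    exact Submodule.sum_mem _ fun i _ => Submodule.smul_mem _ _ (Submodule.subset_span ⟨i, rfl⟩)
  refine ⟨Module.Basis.mk hc.linearIndependent hspan, fun i => ?_, ?_⟩
  · rw [Module.Basis.mk_apply]
  · rwa [Module.Basis.coe_mk]

end Isometry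

end InnerForm

end HomogeneousSpace

namespace HomogeneousSpace

open Filter Topology Set

/-! ### The limit metric and the intermediate subalgebra -/

section Limit

variable {E : Type*} [NormedAddCommGroup E] [NormedSpace ℝ E] [FiniteDimensional ℝ E]
  {G : Type*} [TopologicalSpace G] [ChartedSpace E G] [Group G] [LieGroup 𝓘(ℝ, E) ∞ G]
  {F : Type*} [NormedAddCommGroup F] [NormedSpace ℝ F]
  {H : Subgroup G} [ChartedSpace F H]
  {Q : InnerForm (LieAlg E G)} {ι : Type*} [Fintype ι] [DecidableEq ι]
  {f : Module.Basis ι ℝ (isotropySpace F Q H)} {y : ι → ℝ}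

/-- The invariant metric with inverse eigenvalues `y` on the complement of the frame vectors with
`y j = 0`. -/
theorem exists_invariantMetric_kernelOrthogonal (hQ : IsBiInvariant Q)
    (hf : (Q.restrict (isotropySpace F Q H)).Orthonormal f) (hy : ∀ i, 0 ≤ y i)
    (hq : ∀ x ∈ H, ∀ i j, y i * Q.form (Ad x (f i : LieAlg E G)) (f j) =
      y j * Q.form (Ad x (f i : LieAlg E G)) (f j))
    {p : Submodule ℝ (LieAlg E G)}
    (hp : p = Q.kernelOrthogonal (fun i => (f i : LieAlg E G)) y ⊓ isotropySpace F Q H) :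
    ∃ h : InvariantMetric H p,
      (∀ (B : LinearMap.BilinForm ℝ p) (t : ι → ℝ),
        (∀ (X : p) i, (X : LieAlg E G) = f i → B X X = t i) →
          h.traceForm B = ∑ i, t i * y i) ∧
      scalarCurvature Q p h.toInnerForm =
        frameScalar Q (fun i : {i // 0 < y i} => (f i : LieAlg E G)) (fun i => y i) ∧
      ∀ X Y : p, h.form X Y =
        ∑ i : {i // 0 < y i}, (y i)⁻¹ * Q.form (X : LieAlg E G) (f i) *
          Q.form (Y : LieAlg E G) (f i) := by
  obtain ⟨c, hcf, hc⟩ := InnerForm.exists_basis_kernelOrthogonal hf hy hp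
  let g := InnerForm.ofBasis c (fun i => (y i)⁻¹) (fun i => inv_pos.mpr i.2)
  have hg : g.Diagonal c (fun i => (y i)⁻¹) := InnerForm.ofBasis_diagonal _ _ _
  refine ⟨⟨g, fun x hx X Y X' Y' hX hY => hg.isometry (A := Ad x) (hQ x) hc (fun i j => ?_)
    X Y X' Y' hX hY⟩, fun B t hB => ?_, ?_, fun X Y => ?_⟩
  · have h := hq x hx i j
    have hi := i.2.ne'
    have hj := j.2.ne'
    rw [hcf, hcf]
    field_simp
    linarith
  · refine (hg.traceForm_eq B).trans ?_
    rw [sum_eq_sum_subtype_pos (y := y)]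
    · refine Finset.sum_congr rfl fun i _ => ?_
      rw [inv_inv, hB (c i) i (hcf i)]
    · intro i hi
      rw [le_antisymm (not_lt.mp hi) (hy i), mul_zero]
  · refine (scalarCurvature_eq_frameScalar hQ.adInvariant hc hg).trans ?_
    simp only [inv_inv, hcf]
  · refine (hg.form_eq_sum X Y).trans (Finset.sum_congr rfl fun i _ => ?_)
    rw [← hc.form_basis, ← hc.form_basis, ← hcf]
    rfl

variable [LieGroup 𝓘(ℝ, F) ∞ H]

theorem Ad_mem_kernelOrthogonal (hQ : IsBiInvariant Q)
    (hH : ContMDiff 𝓘(ℝ, F) 𝓘(ℝ, E) ∞ (Subtype.val : H → G))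
    (hf : (Q.restrict (isotropySpace F Q H)).Orthonormal f)
    (hq : ∀ x ∈ H, ∀ i j, y i * Q.form (Ad x (f i : LieAlg E G)) (f j) =
      y j * Q.form (Ad x (f i : LieAlg E G)) (f j)) {x : G} (hx : x ∈ H) {X : LieAlg E G}
    (hX : X ∈ Q.kernelOrthogonal (fun i => (f i : LieAlg E G)) y) :
    Ad x X ∈ Q.kernelOrthogonal (fun i => (f i : LieAlg E G)) y :=
  InnerForm.isometry_mem_kernelOrthogonal (hQ x)
    (fun _ hX => Ad_mem_isotropySpace hQ hH hx hX) hf (hq x hx) hX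

omit [FiniteDimensional ℝ E] [LieGroup 𝓘(ℝ, E) ∞ G] [LieGroup 𝓘(ℝ, F) ∞ H] [Fintype ι]
  [DecidableEq ι] in
theorem lieOfSubgroup_le_kernelOrthogonal :
    lieOfSubgroup E F H ≤ Q.kernelOrthogonal (fun i => (f i : LieAlg E G)) y :=
  fun Z hZ j _ => (f j).2 Z hZ

/-- The point is that [f i, f j] has no 𝔥-component: for Z in 𝔥, Q(Z, [f i, f j]) = Q([Z, f i], f
j), and [Z, f i] stays in the Ad_H-invariant space orthogonal to f j. Parseval in 𝔪 then applies. -/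
theorem normSq_lie_eq_sum_structureConst (hQ : IsBiInvariant Q)
    (hH : ContMDiff 𝓘(ℝ, F) 𝓘(ℝ, E) ∞ (Subtype.val : H → G))
    (hf : (Q.restrict (isotropySpace F Q H)).Orthonormal f)
    (hq : ∀ x ∈ H, ∀ i j, y i * Q.form (Ad x (f i : LieAlg E G)) (f j) =
      y j * Q.form (Ad x (f i : LieAlg E G)) (f j)) {i j : ι} (hi : 0 < y i) (hj : y j = 0) :
    Q.form ⁅(f i : LieAlg E G), (f j : LieAlg E G)⁆ ⁅(f i : LieAlg E G), (f j : LieAlg E G)⁆ =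
      ∑ k, structureConst Q (fun i => (f i : LieAlg E G)) i j k ^ 2 := by
  have hmem : ⁅(f i : LieAlg E G), (f j : LieAlg E G)⁆ ∈ isotropySpace F Q H := by
    intro Z hZ
    have hfi : (f i : LieAlg E G) ∈ Q.kernelOrthogonal (fun i => (f i : LieAlg E G)) y := by
      intro l hl
      refine (hf i l).trans (if_neg ?_)
      rintro rfl
      exact hi.ne' hl
    have h := lie_mem_of_Ad_invariant hH
      (fun x hx X hX => Ad_mem_kernelOrthogonal hQ hH hf hq hx hX) hZ hfi
    exact (hQ.adInvariant.form_lie Z _ _).symm.trans (h j hj)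
  have h := hf.form_eq_sum ⟨_, hmem⟩ ⟨_, hmem⟩
  exact h.trans (Finset.sum_congr rfl fun k _ => (sq _).symm)

/-- Split 𝔨 = 𝔥 ⊕ (𝔨 ∩ 𝔪). Brackets with 𝔥 stay in 𝔨 by the infinitesimal form of Ad_H-invariance;
brackets within 𝔨 ∩ 𝔪 do so by the vanishing structure constants. -/
theorem lie_mem_kernelOrthogonal (hQ : IsBiInvariant Q)
    (hH : ContMDiff 𝓘(ℝ, F) 𝓘(ℝ, E) ∞ (Subtype.val : H → G))
    (hf : (Q.restrict (isotropySpace F Q H)).Orthonormal f) (hy : ∀ i, 0 ≤ y i)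
    (hq : ∀ x ∈ H, ∀ i j, y i * Q.form (Ad x (f i : LieAlg E G)) (f j) =
      y j * Q.form (Ad x (f i : LieAlg E G)) (f j))
    (hs : ∀ i j k, 0 < y i → 0 < y j → y k = 0 →
      structureConst Q (fun i => (f i : LieAlg E G)) i j k = 0) {X Y : LieAlg E G}
    (hX : X ∈ Q.kernelOrthogonal (fun i => (f i : LieAlg E G)) y)
    (hY : Y ∈ Q.kernelOrthogonal (fun i => (f i : LieAlg E G)) y) :
    ⁅X, Y⁆ ∈ Q.kernelOrthogonal (fun i => (f i : LieAlg E G)) y := by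
  set k := Q.kernelOrthogonal (fun i => (f i : LieAlg E G)) y with hk
  have hlie : ∀ {Z X}, Z ∈ lieOfSubgroup E F H → X ∈ k → ⁅Z, X⁆ ∈ k := fun hZ hX =>
    lie_mem_of_Ad_invariant hH (fun x hx X hX => Ad_mem_kernelOrthogonal hQ hH hf hq hx hX) hZ hX
  have hdec : ∀ X ∈ k, ∃ Z ∈ lieOfSubgroup E F H, ∃ X' ∈ k ⊓ isotropySpace F Q H, Z + X' = X := by
    intro X hX
    have hc : IsCompl (lieOfSubgroup E F H) (isotropySpace F Q H) :=
      LinearMap.BilinForm.isCompl_orthogonal_of_restrict_nondegenerate (B := Q.form)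
        (fun X Y h => (Q.symm Y X).trans h) (Q.restrict (lieOfSubgroup E F H)).nondegenerate
    have hXs : X ∈ lieOfSubgroup E F H ⊔ isotropySpace F Q H := hc.sup_eq_top ▸ Submodule.mem_top
    obtain ⟨Z, hZ, X', hX', rfl⟩ := Submodule.mem_sup.mp hXs
    refine ⟨Z, hZ, X', ⟨?_, hX'⟩, rfl⟩
    have := k.sub_mem hX (lieOfSubgroup_le_kernelOrthogonal hZ)
    rwa [add_sub_cancel_left] at this
  obtain ⟨c, hcf, -⟩ := InnerForm.exists_basis_kernelOrthogonal hf hy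
    (p := k ⊓ isotropySpace F Q H) rfl
  have hpp : ∀ X' ∈ k ⊓ isotropySpace F Q H, ∀ Y' ∈ k ⊓ isotropySpace F Q H, ⁅X', Y'⁆ ∈ k := by
    intro X' hX' Y' hY'
    have hXs : X' = ∑ i, c.repr ⟨X', hX'⟩ i • (f i : LieAlg E G) := by
      have h := congrArg Subtype.val (c.sum_repr ⟨X', hX'⟩)
      rw [Submodule.coe_sum] at h
      simpa only [Submodule.coe_smul, hcf] using h.symm
    have hYs : Y' = ∑ i, c.repr ⟨Y', hY'⟩ i • (f i : LieAlg E G) := by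
      have h := congrArg Subtype.val (c.sum_repr ⟨Y', hY'⟩)
      rw [Submodule.coe_sum] at h
      simpa only [Submodule.coe_smul, hcf] using h.symm
    rw [hXs, hYs, sum_lie]
    refine Submodule.sum_mem _ fun i _ => ?_
    rw [lie_sum]
    refine Submodule.sum_mem _ fun j _ => ?_
    rw [smul_lie, lie_smul]
    exact k.smul_mem _ (k.smul_mem _ fun l hl => hs i j l i.2 j.2 hl)
  obtain ⟨Z, hZ, X', hX', rfl⟩ := hdec X hX
  obtain ⟨W, hW, Y', hY', rfl⟩ := hdec Y hY
  rw [add_lie, lie_add X']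
  refine k.add_mem (hlie hZ hY) (k.add_mem ?_ (hpp X' hX' Y' hY'))
  rw [← lie_skew]
  exact k.neg_mem (hlie hW hX'.1)

end Limit

end HomogeneousSpace

/-! ### Boundedness of the inverse eigenvalues -/

namespace HomogeneousSpace

open Filter Topology Set

/-- Positive weights `w` with `t i * w i ≤ 1`, where `t i` tends to a positive limit, converge
along ultrafilters. -/
theorem exists_tendsto_of_mul_le_one {α : Type*} (U : Ultrafilter α) {t w : α → ℝ} {t₀ : ℝ}
    (ht₀ : 0 < t₀) (ht : Tendsto t U (𝓝 t₀)) (hw : ∀ a, 0 < w a) (htw : ∀ a, t a * w a ≤ 1) :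
    ∃ y : ℝ, Tendsto w U (𝓝 y) := by
  -- Eventually t exceeds t₀ / 2, whence w ≤ 2 / t₀.
  have h : ∀ᶠ a in (U : Filter α), w a ∈ Icc 0 (2 / t₀) := by
    filter_upwards [ht.eventually_const_lt (half_lt_self ht₀)] with a ha
    refine ⟨(hw a).le, ?_⟩
    rw [le_div_iff₀ ht₀]
    nlinarith [htw a, mul_lt_mul_of_pos_right ha (hw a)]
  obtain ⟨y, -, hy⟩ := isCompact_iff_ultrafilter_le_nhds.mp (isCompact_Icc (a := (0 : ℝ))
    (b := 2 / t₀)) (U.map w) (le_principal_iff.mpr h)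
  exact ⟨y, hy⟩

end HomogeneousSpace

/-! ### Compactness of the superlevel set -/

open Filter Topology Set HomogeneousSpace

theorem mainTheorem2
    {E : Type*} [NormedAddCommGroup E] [NormedSpace ℝ E] [FiniteDimensional ℝ E]
    {G : Type*} [TopologicalSpace G] [ChartedSpace E G] [Group G] [LieGroup 𝓘(ℝ, E) ∞ G]
    [CompactSpace G]
    {F : Type*} [NormedAddCommGroup F] [NormedSpace ℝ F] [FiniteDimensional ℝ F]
    (H : Subgroup G) [ChartedSpace F H] [LieGroup 𝓘(ℝ, F) ∞ H] [CompactSpace H]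
    (hH : ContMDiff 𝓘(ℝ, F) 𝓘(ℝ, E) ∞ (Subtype.val : H → G))
    (Q : HomogeneousSpace.InnerForm (HomogeneousSpace.LieAlg E G))
    (hQ : HomogeneousSpace.IsBiInvariant Q)
    (T : HomogeneousSpace.Metrics F Q H)
    (a : ℝ) (ha : HomogeneousSpace.alphaGH Q H T < (a : EReal)) :
    IsCompact {g : HomogeneousSpace.metricsT Q H T |
      a ≤ HomogeneousSpace.scalarCurvatureGH Q H (g : HomogeneousSpace.Metrics F Q H)} := by
  rw [isCompact_iff_ultrafilter_le_nhds]
  intro U hU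
  choose f x hf hx hxpos using fun g : metricsT Q H T =>
    (Q.restrict (isotropySpace F Q H)).exists_orthonormal_diagonal g.1.toInnerForm
  have hs : ∀ᶠ g in (U : Filter (metricsT Q H T)),
      a ≤ frameScalar Q (fun i => (f g i : LieAlg E G)) (fun i => (x g i)⁻¹) := by
    filter_upwards [le_principal_iff.mp hU] with g hg
    have h : scalarCurvatureGH Q H g.1 =
        frameScalar Q (fun i => (f g i : LieAlg E G)) (fun i => (x g i)⁻¹) :=
      scalarCurvature_eq_frameScalar hQ.adInvariant (hf g) (hx g)
    rw [← h]
    exact hg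
  have htr : ∀ g : metricsT Q H T, ∑ i, T.form (f g i) (f g i) * (x g i)⁻¹ = 1 := fun g =>
    ((hx g).traceForm_eq T.form).symm.trans g.2
  have hwpos : ∀ g i, 0 < (x g i)⁻¹ := fun g i => inv_pos.mpr (hxpos g i)
  obtain ⟨f₁, hf₁, hlim⟩ :=
    (Q.restrict (isotropySpace F Q H)).exists_orthonormal_limit U (fun g i => f g i) hf
  obtain ⟨f₀, rfl⟩ : ∃ f₀ : Module.Basis _ ℝ (isotropySpace F Q H), ⇑f₀ = f₁ :=
    ⟨Module.Basis.mk hf₁.linearIndependent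
      (hf₁.linearIndependent.span_eq_top_of_card_eq_finrank' (by simp)).ge, Module.Basis.coe_mk _ _⟩
  have hlimL : ∀ i, WeakTendsto (fun g => (f g i : LieAlg E G)) U (f₀ i : LieAlg E G) := fun i =>
    (hlim i).map (isotropySpace F Q H).subtype
  have hTlim : ∀ i, Tendsto (fun g => T.form (f g i) (f g i)) U (𝓝 (T.form (f₀ i) (f₀ i))) :=
    fun i => (hlim i).bilin (hlim i) T.form
  have hwlim : ∀ i, ∃ y : ℝ, Tendsto (fun g => (x g i)⁻¹) U (𝓝 y) := fun i => by
    refine exists_tendsto_of_mul_le_one U (T.pos _ (f₀.ne_zero i)) (hTlim i) (fun g => hwpos g i)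
      fun g => ?_
    rw [← htr g]
    exact Finset.single_le_sum (f := fun i => T.form (f g i) (f g i) * (x g i)⁻¹)
      (fun i _ => mul_nonneg (T.pos _ ((f g).ne_zero i)).le (hwpos g i).le) (Finset.mem_univ i)
  choose y hy using hwlim
  have hy0 : ∀ i, 0 ≤ y i := fun i => ge_of_tendsto (hy i) (.of_forall fun g => (hwpos g i).le)
  have htr₀ : ∑ i, T.form (f₀ i) (f₀ i) * y i = 1 := by
    refine tendsto_nhds_unique (tendsto_finsetSum _ fun i _ => (hTlim i).mul (hy i)) ?_
    simp_rw [htr]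
    exact tendsto_const_nhds
  -- Commutation of Ad_H with the metric, written with inverse eigenvalues so that it survives the
  -- limit even where y vanishes.
  have hq : ∀ x ∈ H, ∀ i j, y i * Q.form (Ad x (f₀ i : LieAlg E G)) (f₀ j) =
      y j * Q.form (Ad x (f₀ i : LieAlg E G)) (f₀ j) := by
    intro z hz i j
    have hb : Tendsto (fun g => Q.form (Ad z (f g i : LieAlg E G)) (f g j)) U
        (𝓝 (Q.form (Ad z (f₀ i : LieAlg E G)) (f₀ j))) :=
      ((hlimL i).map (Ad z)).bilin (hlimL j) Q.form
    refine tendsto_nhds_unique ((hy i).mul hb) (((hy j).mul hb).congr fun g => ?_)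
    have h := (hx g).mul_form_isometry (A := Ad z) (hQ z)
      (fun X hX => Ad_mem_isotropySpace hQ hH hz hX) (g.1.invariant z hz) (hf g) i j
    have h1 := (hxpos g i).ne'
    have h2 := (hxpos g j).ne'
    field_simp
    linarith
  have hscal := le_frameScalar_limit (f := fun g i => (f g i : LieAlg E G))
    (f₀ := fun i => (f₀ i : LieAlg E G)) (w := fun g i => (x g i)⁻¹) hQ.adInvariant hlimL hy hwpos
    hs fun i j hi hj => normSq_lie_eq_sum_structureConst hQ hH hf₁ hq hi hj
  have hsc : ∀ i j k, 0 < y i → 0 < y j → y k = 0 →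
      structureConst Q (fun i => (f₀ i : LieAlg E G)) i j k = 0 := fun i j k hi hj hk =>
    structureConst_eq_zero_of_le_frameScalar (f := fun g i => (f g i : LieAlg E G))
      (w := fun g i => (x g i)⁻¹) hlimL hy hwpos hs hi hj hk
  by_cases hJ : ∃ j, y j = 0
  · obtain ⟨j, hj⟩ := hJ
    -- Otherwise the limit trace would be 0 instead of 1. This f₀ i shows 𝔥 ≠ 𝔨, and f₀ j shows 𝔨 ≠
    -- 𝔤.
    obtain ⟨i, hi⟩ : ∃ i, 0 < y i := by
      by_contra! h
      rw [Finset.sum_eq_zero fun i _ => by rw [le_antisymm (h i) (hy0 i), mul_zero]] at htr₀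
      exact zero_ne_one htr₀
    let k : LieSubalgebra ℝ (LieAlg E G) :=
      { Q.kernelOrthogonal (fun i => (f₀ i : LieAlg E G)) y with
        lie_mem' := lie_mem_kernelOrthogonal hQ hH hf₁ hy0 hq hsc }
    have hk : IsIntermediate F H k := by
      refine ⟨lt_of_le_of_ne lieOfSubgroup_le_kernelOrthogonal fun h => ?_,
        lt_top_iff_ne_top.mpr fun h => ?_,
        fun z hz X hX => Ad_mem_kernelOrthogonal hQ hH hf₁ hq hz hX⟩
      · have hik : (f₀ i : LieAlg E G) ∈ k.toSubmodule := fun l hl =>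
          (hf₁ i l).trans (if_neg (by rintro rfl; exact hi.ne' hl))
        rw [← h] at hik
        exact one_ne_zero (((hf₁ i i).trans (if_pos rfl)).symm.trans ((f₀ i).2 _ hik))
      · have hjk : (f₀ j : LieAlg E G) ∈ k.toSubmodule := by
          rw [show k.toSubmodule = ⊤ from h]
          exact Submodule.mem_top
        exact one_ne_zero (((hf₁ j j).trans (if_pos rfl)).symm.trans (hjk j hj))
    obtain ⟨h, hhT, hhS, -⟩ := exists_invariantMetric_kernelOrthogonal hQ hf₁ hy0 hq
      (p := fiberSpace F Q H k.toSubmodule) rfl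
    have h1 : h.traceForm (restrictFiber Q H T k.toSubmodule) = 1 := by
      rw [← htr₀]
      refine hhT _ _ fun X i hX => ?_
      have : Submodule.inclusion inf_le_right X = f₀ i := Subtype.ext hX
      simp only [restrictFiber, LinearMap.compl₁₂_apply, this]
    have h2 : (scalarCurvature Q (fiberSpace F Q H k.toSubmodule) h.toInnerForm : EReal) ≤
        alphaGH Q H T :=
      (le_iSup₂ (f := fun (h : FiberMetrics F Q H k.toSubmodule)
        (_ : h.traceForm (restrictFiber Q H T k.toSubmodule) = 1) =>
        (scalarCurvature Q (fiberSpace F Q H k.toSubmodule) h.toInnerForm : EReal)) h h1).trans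
        (le_iSup₂ (f := fun (k : LieSubalgebra ℝ (LieAlg E G)) (_ : IsIntermediate F H k) =>
          alphaOf Q H T k.toSubmodule) k hk)
    rw [← hhS] at hscal
    exact absurd (EReal.coe_le_coe_iff.mpr hscal) (not_le.mpr (h2.trans_lt ha))
  · push Not at hJ
    have hypos : ∀ i, 0 < y i := fun i => (hy0 i).lt_of_ne' (hJ i)
    -- With no blown-up direction the orthogonality condition is empty, so the construction gives a
    -- metric on all of 𝔪, and `hscal` bounds its scalar curvature below by a.
    obtain ⟨h, hhT, hhS, hhf⟩ := exists_invariantMetric_kernelOrthogonal hQ hf₁ hy0 hq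
      (p := isotropySpace F Q H)
      (le_antisymm (fun X hX => ⟨fun j hj => absurd hj (hJ j), hX⟩) inf_le_right)
    have h1 : h.traceForm T.form = 1 := by
      rw [← htr₀]
      refine hhT _ _ fun X i hX => ?_
      rw [show X = f₀ i from Subtype.ext hX]
    refine ⟨⟨h, h1⟩, hscal.trans_eq hhS.symm, ?_⟩
    -- Convergence of metrics is pointwise convergence of g(X, Y) = ∑ x i Q(X, f i) Q(Y, f i), where
    -- x i → 1 / y i because y i ≠ 0.
    rw [nhds_subtype, nhds_induced, comap_comap, ← tendsto_iff_comap]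
    refine tendsto_pi_nhds.mpr fun X => tendsto_pi_nhds.mpr fun Y => ?_
    have h2 : ∀ g : metricsT Q H T, g.1.form X Y = ∑ i, x g i *
        (Q.restrict _).form X (f g i) * (Q.restrict _).form Y (f g i) := fun g => by
      simp_rw [(hf g).form_basis]
      exact (hx g).form_eq_sum X Y
    have h3 : h.form X Y = ∑ i, (y i)⁻¹ *
        (Q.restrict _).form X (f₀ i) * (Q.restrict _).form Y (f₀ i) := by
      rw [hhf, sum_eq_sum_subtype_pos fun i hi => absurd (hypos i) hi]
      rfl
    refine Tendsto.congr (fun g => (h2 g).symm) ?_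
    change Tendsto _ _ (𝓝 (h.form X Y))
    rw [h3]
    refine tendsto_finsetSum _ fun i _ => Tendsto.mul (Tendsto.mul ?_ ?_) ?_
    · simpa using (hy i).inv₀ (hJ i)
    · exact hlim i ((Q.restrict _).form X)
    · exact hlim i ((Q.restrict _).form Y)
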